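/- A Boolean relation of arity $n$ is a set $R\subseteq\{0,1\}^n$. It is $i$-valid ($i\in\{0,1\}$) if $(i,\dots,i)\in R$; it is horn (co-horn) if it is the set of vectors satisfying a finite conjunction of clauses, each of which has at most one positive (at most one negative) literal. Let $S$ be a possibly infinite class of Boolean relations, with no effectiveness requirement. An $S$-formula over a set of variables $V$ is an expression $R(y_1,\dots,y_n)$ with $R\in S$ of arity $n$ and $y_1,\dots,y_n\in V$. A set $C$ of such formulas is finitely satisfiable if every finite subset of $C$ is satisfied by some truth assignment, and a set $H\subseteq V$ is homogeneous for $C$ if there is a truth value $c$ such that every finite subset of $C$ is satisfied by a truth assignment that is constantly $c$ on $H$. $\mathrm{LRSAT}(S)$ is the following statement of second-order arithmetic: for every finitely satisfiable set $C$ of $S$-formulas over an infinite set of variables $V$ and every infinite $L\subseteq V$, there is an infinite set $H\subseteq L$ that is homogeneous for $C$. Let $[x\neq y]$ be the relation $\{(0,1),(1,0)\}$. Below, "$\mathsf{RCA}_0\vdash P$" means that $P$ holds in every model of $\mathsf{RCA}_0$. Theorem. Consider the conditions (a) every relation in $S$ is $0$-valid; (b) every relation in $S$ is $1$-valid; (c)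 every relation in $S$ is horn; (d) every relation in $S$ is co-horn. If $S$ satisfies one of (a)-(d), then $\mathsf{RCA}_0\vdash\mathrm{LRSAT}(S)$. If all relations in $S$ are non-empty and $S$ satisfies none of (a)-(d), then $\mathsf{RCA}_0\vdash \mathrm{LRSAT}(S)\rightarrow\mathrm{LRSAT}(\{[x\neq y]\})$. This holds for every class $S$ of (standard) Boolean relations, interpreted in a model of $\mathsf{RCA}_0$ by the codes of its members. It also holds inside every model of $\mathsf{RCA}_0$, for every class $S$ of Boolean relations in the sense of the model (the class need not be a set of the model, and its members may have nonstandard arity), the notions of non-empty, $0$-valid, $1$-valid, horn and co-horn relation being those of the model. -/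

import Mathlib

universe u

/-! ### Boolean relations -/

/-- A Boolean relation `R ⊆ {0,1}ⁿ` together with its arity `n`. -/
structure BoolRel where
  arity : ℕ
  carrier : Set (Fin arity → Bool)

/-- A clause over `n` variables: the disjunction of the variables in `pos` and of the negations of
the variables in `neg`. -/
structure BoolClause (n : ℕ) where
  pos : Finset (Fin n)
  neg : Finset (Fin n)

namespace BoolClause

def Holds {n : ℕ} (c : BoolClause n) (v : Fin n → Bool) : Prop :=
  (∃ i ∈ c.pos, v i = true) ∨ (∃ i ∈ c.neg, v i = false)

/-- At most one positive literal. -/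
def IsHorn {n : ℕ} (c : BoolClause n) : Prop := c.pos.card ≤ 1

/-- At most one negative literal. -/
def IsCoHorn {n : ℕ} (c : BoolClause n) : Prop := c.neg.card ≤ 1

end BoolClause

namespace BoolRel

/-- `R` is `b`-valid: it contains the constant vector `(b, …, b)`. -/
def IsValid (b : Bool) (R : BoolRel) : Prop := (fun _ => b) ∈ R.carrier

/-- `R` is defined by a finite conjunction of horn clauses. -/
def IsHorn (R : BoolRel) : Prop :=
  ∃ F : Finset (BoolClause R.arity),
    (∀ c ∈ F, c.IsHorn) ∧ ∀ v, v ∈ R.carrier ↔ ∀ c ∈ F, c.Holds v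

/-- `R` is defined by a finite conjunction of co-horn clauses. -/
def IsCoHorn (R : BoolRel) : Prop :=
  ∃ F : Finset (BoolClause R.arity),
    (∀ c ∈ F, c.IsCoHorn) ∧ ∀ v, v ∈ R.carrier ↔ ∀ c ∈ F, c.Holds v

/-- The relation `[x ≠ y]`. -/
def neq : BoolRel where
  arity := 2
  carrier := {v | v 0 ≠ v 1}

/-- All relations of `S` are `0`-valid, or all are `1`-valid, or all are horn, or all are
co-horn. -/
def Tame (S : Set BoolRel) : Prop :=
  (∀ R ∈ S, R.IsValid false) ∨ (∀ R ∈ S, R.IsValid true) ∨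
    (∀ R ∈ S, R.IsHorn) ∨ (∀ R ∈ S, R.IsCoHorn)

end BoolRel

/-! ### The language of second-order arithmetic -/

/-- Number terms; the variables are `var 0, var 1, …` (de Bruijn indices). -/
inductive NumTerm where
  | var (i : ℕ)
  | zero
  | one
  | add (s t : NumTerm)
  | mul (s t : NumTerm)

/-- Bounded quantifier formulas. `mem t i` says that `t` belongs to the `i`-th set variable, and
`ball t φ` is `∀ x < t, φ`, where `x` is variable `0` of `φ` and does not occur in `t`. The other
connectives and the bounded existential quantifier are abbreviations. -/
inductive BddFormula where
  | eq (s t : NumTerm)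
  | lt (s t : NumTerm)
  | mem (t : NumTerm) (i : ℕ)
  | neg (φ : BddFormula)
  | and (φ ψ : BddFormula)
  | ball (t : NumTerm) (φ : BddFormula)

/-- A structure for the language of second-order arithmetic: a first-order part, and a nonempty
collection of subsets of it over which the set variables range. -/
structure L2Structure : Type (u + 1) where
  Num : Type u
  zero : Num
  one : Num
  add : Num → Num → Num
  mul : Num → Num → Num
  lt : Num → Num → Prop
  sets : Set (Set Num)
  sets_nonempty : sets.Nonempty

namespace L2Structure

variable (M : L2Structure.{u})

instance : Zero M.Num := ⟨M.zero⟩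

instance : One M.Num := ⟨M.one⟩

instance : Add M.Num := ⟨M.add⟩

instance : Mul M.Num := ⟨M.mul⟩

instance : LT M.Num := ⟨M.lt⟩

variable {M}

/-- The valuation `a, e 0, e 1, …`. -/
def push (a : M.Num) (e : ℕ → M.Num) : ℕ → M.Num
  | 0 => a
  | k + 1 => e k

def termVal (e : ℕ → M.Num) : NumTerm → M.Num
  | .var i => e i
  | .zero => 0
  | .one => 1
  | .add s t => termVal e s + termVal e t
  | .mul s t => termVal e s * termVal e t

/-- Truth of a bounded quantifier formula under the set valuation `X` and the number
valuation `e`. -/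
def Sat (X : ℕ → Set M.Num) : BddFormula → (ℕ → M.Num) → Prop
  | .eq s t, e => termVal e s = termVal e t
  | .lt s t, e => termVal e s < termVal e t
  | .mem t i, e => termVal e t ∈ X i
  | .neg φ, e => ¬ Sat X φ e
  | .and φ ψ, e => Sat X φ e ∧ Sat X ψ e
  | .ball t φ, e => ∀ a, a < termVal e t → Sat X φ (push a e)

/-- `M` is a model of `RCA₀`: the basic axioms, `Σ⁰₁` induction and `Δ⁰₁` comprehension, the two
schemes with arbitrary number and set parameters. -/
structure IsModelRCA₀ (M : L2Structure.{u}) : Prop where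
  succ_ne_zero : ∀ n : M.Num, n + 1 ≠ 0
  succ_inj : ∀ m n : M.Num, m + 1 = n + 1 → m = n
  add_zero : ∀ m : M.Num, m + 0 = m
  add_succ : ∀ m n : M.Num, m + (n + 1) = (m + n) + 1
  mul_zero : ∀ m : M.Num, m * 0 = 0
  mul_succ : ∀ m n : M.Num, m * (n + 1) = m * n + m
  not_lt_zero : ∀ m : M.Num, ¬ m < 0
  lt_succ_iff : ∀ m n : M.Num, m < n + 1 ↔ m < n ∨ m = n
  sigma_induction : ∀ (φ : BddFormula) (X : ℕ → Set M.Num) (e : ℕ → M.Num),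
    (∀ i, X i ∈ M.sets) →
    (∃ m, Sat X φ (push m (push 0 e))) →
    (∀ n, (∃ m, Sat X φ (push m (push n e))) → ∃ m, Sat X φ (push m (push (n + 1) e))) →
    ∀ n, ∃ m, Sat X φ (push m (push n e))
  delta_comprehension : ∀ (φ ψ : BddFormula) (X : ℕ → Set M.Num) (e : ℕ → M.Num),
    (∀ i, X i ∈ M.sets) →
    (∀ n, (∃ m, Sat X φ (push m (push n e))) ↔ ∀ m, Sat X ψ (push m (push n e))) →
    {n | ∃ m, Sat X φ (push m (push n e))} ∈ M.sets

/-! ### Coding of finite objects inside a structure -/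

/-- The pair `(i, j)`, coded by `(i + j)² + i`. -/
def pair (i j : M.Num) : M.Num := (i + j) * (i + j) + i

/-- Membership in the finite set coded by `c`: the triple `(k, (m, n))` codes the set of all `i < k`
such that `m (i + 1) + 1` divides `n`. -/
def InCode (i c : M.Num) : Prop :=
  ∃ k m n, c = pair k (pair m n) ∧ i < k ∧ ∃ q, n = q * (m * (i + 1) + 1)

/-- `c` is the least code of the finite set that it codes, so that every finite set has exactly one
such code. -/
def IsFinCode (c : M.Num) : Prop :=
  ∀ d, d < c → ∃ i, ¬ (InCode i d ↔ InCode i c)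

/-- `a` codes a vector of `{0,1}ⁿ`, as the set of the coordinates at which it is `1`. -/
def IsVec (n a : M.Num) : Prop :=
  IsFinCode a ∧ ∀ i, InCode i a → i < n

/-- `ρ = (n, r)` codes an `n`-ary Boolean relation, `r` being the code of its set of vectors. -/
def IsRel (ρ : M.Num) : Prop :=
  ∃ n r, ρ = pair n r ∧ IsFinCode r ∧ ∀ a, InCode a r → IsVec n a

/-- `s` codes a sequence of length `n`, as a finite set of pairs `(i, yᵢ)` with `i < n`. -/
def IsSeq (n s : M.Num) : Prop :=
  IsFinCode s ∧ (∀ p, InCode p s → ∃ i y, i < n ∧ p = pair i y) ∧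
    ∀ i, i < n → ∃! y, InCode (pair i y) s

/-- `φ` codes a formula `R(y₀, …, yₙ₋₁)` with `R ∈ S` and all `yᵢ ∈ V`; the variables are numbers. -/
def IsFormulaOver (S V : Set M.Num) (φ : M.Num) : Prop :=
  ∃ n r s, φ = pair (pair n r) s ∧ pair n r ∈ S ∧ IsRel (pair n r) ∧ IsSeq n s ∧
    ∀ i y, InCode (pair i y) s → y ∈ V

/-- The truth assignment that makes exactly the variables in `ν` true satisfies `φ`. -/
def Satisfies (ν : Set M.Num) (φ : M.Num) : Prop :=
  ∃ n r s, φ = pair (pair n r) s ∧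
    ∃ a, InCode a r ∧ ∀ i y, InCode (pair i y) s → (InCode i a ↔ y ∈ ν)

/-! ### The principles `LRSAT(S)` -/

/-- `X` is infinite in the sense of the structure. -/
def IsInf (X : Set M.Num) : Prop := ∀ b, ∃ x ∈ X, b < x

/-- `D` is a finite set in the sense of the structure. -/
def IsFinSet (D : Set M.Num) : Prop := D ∈ M.sets ∧ ∃ b, ∀ x ∈ D, x < b

/-- Every finite subset of `C` is satisfiable. -/
def FinSatisfiable (C : Set M.Num) : Prop :=
  ∀ D, IsFinSet D → D ⊆ C → ∃ ν ∈ M.sets, ∀ φ ∈ D, Satisfies ν φ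

/-- For some truth value `c`, every finite subset of `C` is satisfied by an assignment with constant
value `c` on `H`. -/
def IsHomogeneous (C H : Set M.Num) : Prop :=
  ∃ c : Bool, ∀ D, IsFinSet D → D ⊆ C →
    ∃ ν ∈ M.sets, (∀ φ ∈ D, Satisfies ν φ) ∧ ∀ x ∈ H, (x ∈ ν ↔ c = true)

variable (M) in
/-- `LRSAT(S)` holds in `M`, where `S` is a class of codes of Boolean relations. -/
def LRSAT (S : Set M.Num) : Prop :=
  ∀ V ∈ M.sets, ∀ C ∈ M.sets, ∀ L ∈ M.sets,
    IsInf V → L ⊆ V → IsInf L → (∀ φ ∈ C, IsFormulaOver S V φ) → FinSatisfiable C →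
    ∃ H ∈ M.sets, H ⊆ L ∧ IsInf H ∧ IsHomogeneous C H

/-! ### Classes of Boolean relations inside a structure -/

variable (M) in
/-- The numeral of a standard natural number. -/
def num : ℕ → M.Num
  | 0 => 0
  | k + 1 => num k + 1

/-- `ρ` is the code in `M` of the Boolean relation `R`. -/
def Codes (ρ : M.Num) (R : BoolRel) : Prop :=
  IsRel ρ ∧ ∃ r, ρ = pair (M.num R.arity) r ∧
    ∀ v : Fin R.arity → Bool, v ∈ R.carrier ↔
      ∃ a, InCode a r ∧ ∀ i : Fin R.arity, (InCode (M.num i) a ↔ v i = true)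

variable (M) in
/-- The class of the codes in `M` of the relations in `S`. -/
def codesOf (S : Set BoolRel) : Set M.Num := {ρ | ∃ R ∈ S, Codes ρ R}

/-- The coded relation `ρ` has an element. -/
def RelNonempty (ρ : M.Num) : Prop :=
  ∃ n r, ρ = pair n r ∧ ∃ a, InCode a r

/-- The coded relation `ρ` contains the vector `(0, …, 0)`. -/
def RelZeroValid (ρ : M.Num) : Prop :=
  ∃ n r, ρ = pair n r ∧ ∃ a, InCode a r ∧ ∀ i, i < n → ¬ InCode i a

/-- The coded relation `ρ` contains the vector `(1, …, 1)`. -/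
def RelOneValid (ρ : M.Num) : Prop :=
  ∃ n r, ρ = pair n r ∧ ∃ a, InCode a r ∧ ∀ i, i < n → InCode i a

/-- `c = (p, q)` codes a clause over the variables `i < n`, with positive literals the `i` in `p`
and negative literals the `¬ i` for `i` in `q`. -/
def IsClause (n c : M.Num) : Prop :=
  ∃ p q, c = pair p q ∧ (∀ i, InCode i p → i < n) ∧ ∀ i, InCode i q → i < n

def ClauseHolds (c a : M.Num) : Prop :=
  ∃ p q, c = pair p q ∧ ((∃ i, InCode i p ∧ InCode i a) ∨ ∃ i, InCode i q ∧ ¬ InCode i a)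

/-- At most one positive literal. -/
def HornClause (c : M.Num) : Prop :=
  ∃ p q, c = pair p q ∧ ∀ i j, InCode i p → InCode j p → i = j

/-- At most one negative literal. -/
def CoHornClause (c : M.Num) : Prop :=
  ∃ p q, c = pair p q ∧ ∀ i j, InCode i q → InCode j q → i = j

/-- The coded relation `ρ` is defined by a coded finite set `f` of horn clauses. -/
def RelHorn (ρ : M.Num) : Prop :=
  ∃ n r, ρ = pair n r ∧ ∃ f, (∀ c, InCode c f → IsClause n c ∧ HornClause c) ∧
    ∀ a, IsVec n a → (InCode a r ↔ ∀ c, InCode c f → ClauseHolds c a)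

/-- The coded relation `ρ` is defined by a coded finite set `f` of co-horn clauses. -/
def RelCoHorn (ρ : M.Num) : Prop :=
  ∃ n r, ρ = pair n r ∧ ∃ f, (∀ c, InCode c f → IsClause n c ∧ CoHornClause c) ∧
    ∀ a, IsVec n a → (InCode a r ↔ ∀ c, InCode c f → ClauseHolds c a)

/-- All relations coded in `S` are `0`-valid, or all are `1`-valid, or all are horn, or all are
co-horn, in the sense of the structure. -/
def RelTame (S : Set M.Num) : Prop :=
  (∀ ρ ∈ S, RelZeroValid ρ) ∨ (∀ ρ ∈ S, RelOneValid ρ) ∨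
    (∀ ρ ∈ S, RelHorn ρ) ∨ (∀ ρ ∈ S, RelCoHorn ρ)

end L2Structure

/-- `RCA₀` proves `P`: the statement `P` holds in every model of `RCA₀`. -/
def RCA₀Proves (P : L2Structure.{u} → Prop) : Prop :=
  ∀ M : L2Structure.{u}, M.IsModelRCA₀ → P M

/-! Tame classes. If all relations are `0`-valid or all are `1`-valid, a constant assignment
satisfies everything and `L` itself is homogeneous. The horn and co-horn cases become one after an
exchange of truth values (`polar`). The models of the formulas below `d` are then closed under
intersection, so there is a least one, and it consists of the variables forced to be true. Either,
for some `b` and all `d`, some model avoids all of `L` above `b`, and this tail of `L` is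
homogeneous; or the forced elements of `L` are unbounded. Being forced is `Σ⁰₁`, so there is an
infinite set of forced elements, and it is homogeneous for the other value
(`exists_homogeneous_of_least_models`). Comprehension is never applied to `S`, which may therefore
be any class.

Other classes. Pick relations witnessing the failure of each of the four conditions. They yield
finitely many formulas in `x`, `z` and two auxiliary variables `t`, `f` which all hold if `x ≠ z`,
`t = 1`, `f = 0`, and which together imply `x ≠ z` (`lrsat_neq_of_not_relTame`). Replacing each
formula `x ≠ z` by these turns an instance of `[x ≠ y]` into an instance of `S`, and homogeneous
sets carry back (`lrsat_neq_of_templates`). To use the failure of the horn condition, one needs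
inside the model that a relation closed under minima is defined by horn clauses
(`PolarClosed.exists_clauses`).

Everything takes place in an arbitrary model. The classes `BddTerm` and `BddPred` let instance
search find bounded formulas for Lean predicates, so that the axiom schemes apply to them. All
subsets of a bounded set have codes under a common bound (`CodeBound`), which makes a quantifier
over the models of a finite set of formulas bounded. Standard classes reduce to internal ones
because tameness is absolute (`relTame_codesOf_iff`). -/

/-! ### Substitution in bounded formulas -/

namespace NumTerm

/-- Simultaneous substitution. -/
def subst (σ : ℕ → NumTerm) : NumTerm → NumTerm
  | var i => σ i
  | zero => zero
  | one => one
  | add s t => add (s.subst σ) (t.subst σ)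
  | mul s t => mul (s.subst σ) (t.subst σ)

/-- The substitution `σ` under a binder. -/
def lift (σ : ℕ → NumTerm) : ℕ → NumTerm
  | 0 => var 0
  | i + 1 => (σ i).subst fun j => var (j + 1)

end NumTerm

/-- Simultaneous substitution for the number variables. -/
def BddFormula.subst : (ℕ → NumTerm) → BddFormula → BddFormula
  | σ, eq s t => eq (s.subst σ) (t.subst σ)
  | σ, lt s t => lt (s.subst σ) (t.subst σ)
  | σ, mem t i => mem (t.subst σ) i
  | σ, neg φ => neg (φ.subst σ)
  | σ, and φ ψ => and (φ.subst σ) (ψ.subst σ)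
  | σ, ball t φ => ball (t.subst σ) (φ.subst (NumTerm.lift σ))

namespace L2Structure

variable {M : L2Structure.{u}}

theorem termVal_subst (σ : ℕ → NumTerm) (e : ℕ → M.Num) (t : NumTerm) :
    termVal e (t.subst σ) = termVal (fun i => termVal e (σ i)) t := by
  induction t <;> simp_all [NumTerm.subst, termVal]

theorem termVal_lift (σ : ℕ → NumTerm) (e : ℕ → M.Num) (a : M.Num) :
    (fun i => termVal (push a e) (NumTerm.lift σ i)) = push a fun i => termVal e (σ i) := by
  funext i
  cases i with
  | zero => rfl
  | succ i => simp only [NumTerm.lift, termVal_subst]; rfl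

theorem sat_subst (X : ℕ → Set M.Num) (φ : BddFormula) (σ : ℕ → NumTerm) (e : ℕ → M.Num) :
    Sat X (φ.subst σ) e ↔ Sat X φ fun i => termVal e (σ i) := by
  induction φ generalizing σ e with
  | eq s t => simp only [BddFormula.subst, Sat, termVal_subst]
  | lt s t => simp only [BddFormula.subst, Sat, termVal_subst]
  | mem t i => simp only [BddFormula.subst, Sat, termVal_subst]
  | neg φ ih => simp only [BddFormula.subst, Sat, ih]
  | and φ ψ ih₁ ih₂ => simp only [BddFormula.subst, Sat, ih₁, ih₂]
  | ball t φ ih => simp only [BddFormula.subst, Sat, ih, termVal_subst, termVal_lift]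

/-! ### Bounded predicates -/

/-- The valuation `v 0, …, v (k - 1), e 0, e 1, …`. -/
def splice (k : ℕ) (v e : ℕ → M.Num) : ℕ → M.Num := fun i => if i < k then v i else e (i - k)

/-- Entering a bounded quantifier turns `k` free slots into `k + 1`, which is why the classes below
quantify over all `k`. The rest of the valuation is frozen into finitely many parameters; the
formula is chosen only after an enumeration of parameters is given, so that parameter lists can be
appended. -/
theorem push_splice (k : ℕ) (v e : ℕ → M.Num) (a : M.Num) :
    push a (splice k v e) = splice (k + 1) (push a v) e := by
  funext i
  cases i <;> simp [push, splice]

/-- The function `f` of a valuation is given by a term with parameters. -/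
class BddTerm (f : (ℕ → M.Num) → M.Num) : Prop where
  exists_term : ∀ (k : ℕ) (e : ℕ → M.Num), ∃ A : List M.Num, ∀ e' : ℕ → M.Num,
    (∀ a ∈ A, ∃ i, e' i = a) → ∃ t, ∀ v, termVal (splice k v e') t = f (splice k v e)

/-- The property `P` of a valuation is given by a bounded formula with parameters. -/
class BddPred (P : (ℕ → M.Num) → Prop) : Prop where
  exists_formula : ∀ (k : ℕ) (e : ℕ → M.Num), ∃ (A : List M.Num) (B : List (Set M.Num)),
    (∀ Y ∈ B, Y ∈ M.sets) ∧
    ∀ (e' : ℕ → M.Num) (X : ℕ → Set M.Num), (∀ a ∈ A, ∃ i, e' i = a) → (∀ Y ∈ B, ∃ i, X i = Y) →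
      ∃ φ, ∀ v, Sat X φ (splice k v e') ↔ P (splice k v e)

instance BddTerm.const (c : M.Num) : BddTerm fun _ : ℕ → M.Num => c where
  exists_term k e := by
    refine ⟨[c], fun e' h => ?_⟩
    obtain ⟨i, hi⟩ := h c (by simp)
    exact ⟨.var (k + i), fun v => by simp [termVal, splice, hi]⟩

instance BddTerm.var (i : ℕ) : BddTerm fun e : ℕ → M.Num => e i where
  exists_term k e := by
    by_cases hik : i < k
    · exact ⟨[], fun e' _ => ⟨.var i, fun v => by simp [termVal, splice, hik]⟩⟩
    · refine ⟨[e (i - k)], fun e' h => ?_⟩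
      obtain ⟨j, hj⟩ := h (e (i - k)) (by simp)
      exact ⟨.var (k + j), fun v => by simp [termVal, splice, hj, hik]⟩

instance BddTerm.add (f g : (ℕ → M.Num) → M.Num) [hf : BddTerm f] [hg : BddTerm g] :
    BddTerm fun e => f e + g e where
  exists_term k e := by
    obtain ⟨A, hA⟩ := hf.exists_term k e
    obtain ⟨B, hB⟩ := hg.exists_term k e
    refine ⟨A ++ B, fun e' h => ?_⟩
    obtain ⟨s, hs⟩ := hA e' fun a ha => h a (by simp [ha])
    obtain ⟨t, ht⟩ := hB e' fun a ha => h a (by simp [ha])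
    exact ⟨.add s t, fun v => by simp only [termVal, hs, ht]⟩

instance BddTerm.mul (f g : (ℕ → M.Num) → M.Num) [hf : BddTerm f] [hg : BddTerm g] :
    BddTerm fun e => f e * g e where
  exists_term k e := by
    obtain ⟨A, hA⟩ := hf.exists_term k e
    obtain ⟨B, hB⟩ := hg.exists_term k e
    refine ⟨A ++ B, fun e' h => ?_⟩
    obtain ⟨s, hs⟩ := hA e' fun a ha => h a (by simp [ha])
    obtain ⟨t, ht⟩ := hB e' fun a ha => h a (by simp [ha])
    exact ⟨.mul s t, fun v => by simp only [termVal, hs, ht]⟩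

theorem BddPred.congr {P Q : (ℕ → M.Num) → Prop} [hP : BddPred P] (h : ∀ e, Q e ↔ P e) :
    BddPred Q := by
  rwa [show Q = P from funext fun e => propext (h e)]

instance BddPred.eq (f g : (ℕ → M.Num) → M.Num) [hf : BddTerm f] [hg : BddTerm g] :
    BddPred fun e => f e = g e where
  exists_formula k e := by
    obtain ⟨A, hA⟩ := hf.exists_term k e
    obtain ⟨B, hB⟩ := hg.exists_term k e
    refine ⟨A ++ B, [], by simp, fun e' X h _ => ?_⟩
    obtain ⟨s, hs⟩ := hA e' fun a ha => h a (by simp [ha])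
    obtain ⟨t, ht⟩ := hB e' fun a ha => h a (by simp [ha])
    exact ⟨.eq s t, fun v => by simp only [Sat, hs, ht]⟩

instance BddPred.lt (f g : (ℕ → M.Num) → M.Num) [hf : BddTerm f] [hg : BddTerm g] :
    BddPred fun e => f e < g e where
  exists_formula k e := by
    obtain ⟨A, hA⟩ := hf.exists_term k e
    obtain ⟨B, hB⟩ := hg.exists_term k e
    refine ⟨A ++ B, [], by simp, fun e' X h _ => ?_⟩
    obtain ⟨s, hs⟩ := hA e' fun a ha => h a (by simp [ha])
    obtain ⟨t, ht⟩ := hB e' fun a ha => h a (by simp [ha])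
    exact ⟨.lt s t, fun v => by simp only [Sat, hs, ht]⟩

instance BddPred.mem (f : (ℕ → M.Num) → M.Num) (Y : Set M.Num) [hf : BddTerm f]
    [hY : Fact (Y ∈ M.sets)] : BddPred fun e => f e ∈ Y where
  exists_formula k e := by
    obtain ⟨A, hA⟩ := hf.exists_term k e
    refine ⟨A, [Y], by simpa using hY.out, fun e' X h hX => ?_⟩
    obtain ⟨t, ht⟩ := hA e' h
    obtain ⟨i, hi⟩ := hX Y (by simp)
    exact ⟨.mem t i, fun v => by simp only [Sat, ht, hi]⟩

instance BddPred.not (P : (ℕ → M.Num) → Prop) [hP : BddPred P] : BddPred fun e => ¬ P e where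
  exists_formula k e := by
    obtain ⟨A, B, hB, h⟩ := hP.exists_formula k e
    refine ⟨A, B, hB, fun e' X he hX => ?_⟩
    obtain ⟨φ, hφ⟩ := h e' X he hX
    exact ⟨.neg φ, fun v => by simp only [Sat, hφ]⟩

instance BddPred.and (P Q : (ℕ → M.Num) → Prop) [hP : BddPred P] [hQ : BddPred Q] :
    BddPred fun e => P e ∧ Q e where
  exists_formula k e := by
    obtain ⟨A, B, hB, h⟩ := hP.exists_formula k e
    obtain ⟨A', B', hB', h'⟩ := hQ.exists_formula k e
    refine ⟨A ++ A', B ++ B', fun Y hY => (List.mem_append.1 hY).elim (hB Y) (hB' Y),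
      fun e' X he hX => ?_⟩
    obtain ⟨φ, hφ⟩ := h e' X (fun a ha => he a (by simp [ha])) fun Y hY => hX Y (by simp [hY])
    obtain ⟨ψ, hψ⟩ := h' e' X (fun a ha => he a (by simp [ha])) fun Y hY => hX Y (by simp [hY])
    exact ⟨.and φ ψ, fun v => by simp only [Sat, hφ, hψ]⟩

instance BddPred.ball (f : (ℕ → M.Num) → M.Num) (P : (ℕ → M.Num) → M.Num → Prop)
    [hf : BddTerm f] [hP : BddPred fun e => P (fun i => e (i + 1)) (e 0)] :
    BddPred fun e => ∀ a, a < f e → P e a where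
  exists_formula k e := by
    obtain ⟨A, hA⟩ := hf.exists_term k e
    obtain ⟨A', B, hB, h⟩ := hP.exists_formula (k + 1) e
    refine ⟨A ++ A', B, hB, fun e' X he hX => ?_⟩
    obtain ⟨t, ht⟩ := hA e' fun a ha => he a (by simp [ha])
    obtain ⟨φ, hφ⟩ := h e' X (fun a ha => he a (by simp [ha])) hX
    refine ⟨.ball t φ, fun v => ?_⟩
    simp only [Sat, ht, push_splice, hφ]
    simp only [← push_splice]
    rfl

instance BddPred.or (P Q : (ℕ → M.Num) → Prop) [BddPred P] [BddPred Q] :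
    BddPred fun e => P e ∨ Q e :=
  .congr (P := fun e => ¬ (¬ P e ∧ ¬ Q e)) fun e => by tauto

instance BddPred.imp (P Q : (ℕ → M.Num) → Prop) [BddPred P] [BddPred Q] :
    BddPred fun e => P e → Q e :=
  .congr (P := fun e => ¬ (P e ∧ ¬ Q e)) fun e => by tauto

instance BddPred.iff (P Q : (ℕ → M.Num) → Prop) [BddPred P] [BddPred Q] :
    BddPred fun e => P e ↔ Q e :=
  .congr (P := fun e => (P e → Q e) ∧ (Q e → P e)) fun e => by tauto

instance BddPred.bex (f : (ℕ → M.Num) → M.Num) (P : (ℕ → M.Num) → M.Num → Prop)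
    [BddTerm f] [BddPred fun e => P (fun i => e (i + 1)) (e 0)] :
    BddPred fun e => ∃ a, a < f e ∧ P e a :=
  .congr (P := fun e => ¬ ∀ a, a < f e → ¬ P e a) fun e => by push Not; rfl

/-- A predicate shown to be bounded in plain variables can then be used at arbitrary terms without
unfolding its definition again. -/
theorem BddPred.subst (n : ℕ) {P : (ℕ → M.Num) → Prop} [hP : BddPred P]
    (F : Fin n → (ℕ → M.Num) → M.Num) (hF : ∀ i, BddTerm (F i)) :
    BddPred fun e => P fun i => if h : i < n then F ⟨i, h⟩ e else 0 where
  exists_formula k e := by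
    -- The frozen part is constantly `0`, matching the default value of the variables from `n` on.
    obtain ⟨A, B, hB, h⟩ := hP.exists_formula n fun _ => 0
    choose C hC using fun i => (hF i).exists_term k e
    refine ⟨A ++ (List.finRange n).flatMap C, B, hB, fun e' X he hX => ?_⟩
    obtain ⟨φ, hφ⟩ := h e' X (fun a ha => he a (by simp [ha])) hX
    choose t ht using fun i => hC i e' fun a ha => he a
      (List.mem_append.2 (.inr (List.mem_flatMap.2 ⟨i, List.mem_finRange i, ha⟩)))
    refine ⟨φ.subst fun i => if h : i < n then t ⟨i, h⟩ else .var (k + (i - n)), fun v => ?_⟩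
    rw [sat_subst]
    have h₁ : (fun i => termVal (splice k v e')
        (if h : i < n then t ⟨i, h⟩ else .var (k + (i - n)))) =
        splice n (fun i => if h : i < n then F ⟨i, h⟩ (splice k v e) else 0) e' := by
      funext i
      by_cases hi : i < n
      · simp [hi, ht, splice]
      · simp [hi, termVal, splice]
    rw [h₁, hφ]
    apply iff_of_eq
    congr 1
    funext i
    by_cases hi : i < n <;> simp [hi, splice]

theorem BddPred.subst₁ {P : M.Num → Prop} (hP : BddPred fun e : ℕ → M.Num => P (e 0))
    (f : (ℕ → M.Num) → M.Num) [hf : BddTerm f] : BddPred fun e => P (f e) := by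
  have := BddPred.subst (hP := hP) 1 (fun _ => f) fun _ => hf
  simpa using this

theorem BddPred.subst₂ {P : M.Num → M.Num → Prop}
    (hP : BddPred fun e : ℕ → M.Num => P (e 0) (e 1))
    (f g : (ℕ → M.Num) → M.Num) [hf : BddTerm f] [hg : BddTerm g] :
    BddPred fun e => P (f e) (g e) := by
  have := BddPred.subst (hP := hP) 2 ![f, g] (by
    intro i; fin_cases i; exacts [hf, hg])
  simpa using this

theorem BddPred.subst₃ {P : M.Num → M.Num → M.Num → Prop}
    (hP : BddPred fun e : ℕ → M.Num => P (e 0) (e 1) (e 2))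
    (f g h : (ℕ → M.Num) → M.Num) [hf : BddTerm f] [hg : BddTerm g] [hh : BddTerm h] :
    BddPred fun e => P (f e) (g e) (h e) := by
  have := BddPred.subst (hP := hP) 3 ![f, g, h] (by
    intro i; fin_cases i; exacts [hf, hg, hh])
  simpa using this

/-- Two bounded predicates are given by formulas with common parameters. -/
theorem BddPred.exists_eq {P : (ℕ → M.Num) → Prop} (hP : BddPred P) {Q : (ℕ → M.Num) → Prop}
    (hQ : BddPred Q) (e : ℕ → M.Num) : ∃ (φ ψ : BddFormula) (X : ℕ → Set M.Num) (e' : ℕ → M.Num),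
      (∀ i, X i ∈ M.sets) ∧ ∀ m n, (Sat X φ (push m (push n e')) ↔ P (push m (push n e))) ∧
        (Sat X ψ (push m (push n e')) ↔ Q (push m (push n e))) := by
  obtain ⟨A, B, hB, h⟩ := hP.exists_formula 2 e
  obtain ⟨A', B', hB', h'⟩ := hQ.exists_formula 2 e
  obtain ⟨Z, hZ⟩ := M.sets_nonempty
  -- Past the end of the parameter lists, the default `Z` keeps every set variable inside `M.sets`.
  let e' : ℕ → M.Num := fun i => (A ++ A').getD i 0
  let X : ℕ → Set M.Num := fun i => (B ++ B').getD i Z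
  have he : ∀ a ∈ A ++ A', ∃ i, e' i = a := fun a ha => by
    obtain ⟨i, hi, rfl⟩ := List.getElem_of_mem ha
    exact ⟨i, List.getD_eq_getElem _ _ hi⟩
  have hX : ∀ Y ∈ B ++ B', ∃ i, X i = Y := fun a ha => by
    obtain ⟨i, hi, rfl⟩ := List.getElem_of_mem ha
    exact ⟨i, List.getD_eq_getElem _ _ hi⟩
  obtain ⟨φ, hφ⟩ := h e' X (fun a ha => he a (by simp [ha])) fun Y hY => hX Y (by simp [hY])
  obtain ⟨ψ, hψ⟩ := h' e' X (fun a ha => he a (by simp [ha])) fun Y hY => hX Y (by simp [hY])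
  refine ⟨φ, ψ, X, e', fun i => ?_, fun m n => ?_⟩
  · by_cases hi : i < (B ++ B').length
    · have : X i = (B ++ B')[i] := List.getD_eq_getElem _ _ hi
      rw [this]
      exact (List.mem_append.1 (List.getElem_mem hi)).elim (hB _) (hB' _)
    · have : X i = Z := List.getD_eq_default _ _ (not_lt.1 hi)
      rwa [this]
  · have key : ∀ e : ℕ → M.Num, push m (push n e) = splice 2 (push m (push n e)) e := fun e => by
      funext i
      rcases i with _ | _ | i <;> simp [push, splice]
    have key' : ∀ d : ℕ → M.Num, splice 2 (push m (push n e')) d = push m (push n d) := fun d => by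
      funext i
      rcases i with _ | _ | i <;> simp [push, splice]
    have h₁ := hφ (push m (push n e'))
    have h₂ := hψ (push m (push n e'))
    rw [key', key'] at h₁ h₂
    exact ⟨h₁, h₂⟩

end L2Structure

namespace L2Structure

variable {M : L2Structure.{u}} [hM : Fact M.IsModelRCA₀]

/-! ### Induction and comprehension -/

theorem sigma_ind (Q : M.Num → M.Num → Prop) [hQ : BddPred fun e : ℕ → M.Num => Q (e 0) (e 1)]
    (h₀ : ∃ m, Q m 0) (h₁ : ∀ n, (∃ m, Q m n) → ∃ m, Q m (n + 1)) (n : M.Num) : ∃ m, Q m n := by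
  obtain ⟨φ, _, X, e, hX, h⟩ := hQ.exists_eq hQ fun _ => 0
  have h' : ∀ m n, Sat X φ (push m (push n e)) ↔ Q m n := fun m n => (h m n).1
  have := hM.out.sigma_induction φ X e hX
  simp only [h'] at this
  exact this h₀ h₁ n

theorem bdd_ind (P : M.Num → Prop) [hP : BddPred fun e : ℕ → M.Num => P (e 0)]
    (h₀ : P 0) (h₁ : ∀ n, P n → P (n + 1)) (n : M.Num) : P n := by
  have := hP.subst₁ (P := P) (f := fun e => e 1)
  obtain ⟨_, h⟩ := sigma_ind (fun _ n => P n) ⟨0, h₀⟩ (fun n ⟨_, h⟩ => ⟨0, h₁ n h⟩) n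
  exact h

theorem setOf_exists_mem (Q Q' : M.Num → M.Num → Prop)
    [hQ : BddPred fun e : ℕ → M.Num => Q (e 0) (e 1)]
    [hQ' : BddPred fun e : ℕ → M.Num => Q' (e 0) (e 1)]
    (h : ∀ n, (∃ m, Q m n) ↔ ∀ m, Q' m n) : {n | ∃ m, Q m n} ∈ M.sets := by
  obtain ⟨φ, ψ, X, e, hX, hφ⟩ := hQ.exists_eq hQ' fun _ => 0
  have h₁ : ∀ m n, Sat X φ (push m (push n e)) ↔ Q m n := fun m n => (hφ m n).1
  have h₂ : ∀ m n, Sat X ψ (push m (push n e)) ↔ Q' m n := fun m n => (hφ m n).2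
  have := hM.out.delta_comprehension φ ψ X e hX
  simp only [h₁, h₂] at this
  exact this h

theorem setOf_mem (P : M.Num → Prop) [hP : BddPred fun e : ℕ → M.Num => P (e 0)] :
    {n | P n} ∈ M.sets := by
  have := hP.subst₁ (P := P) (f := fun e => e 1)
  have h := setOf_exists_mem (fun _ n => P n) (fun _ n => P n) fun n =>
    ⟨fun ⟨_, h⟩ _ => h, fun h => ⟨0, h 0⟩⟩
  simpa using h

/-! ### The ordered semiring of numbers -/

namespace Num

theorem zero_add' (n : M.Num) : 0 + n = n := by
  refine bdd_ind (fun n => 0 + n = n) (hM.out.add_zero 0) (fun n h => ?_) n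
  rw [hM.out.add_succ, h]

theorem succ_add' (m n : M.Num) : m + 1 + n = m + n + 1 := by
  refine bdd_ind (fun n => m + 1 + n = m + n + 1) ?_ (fun n h => ?_) n
  · rw [hM.out.add_zero, hM.out.add_zero]
  · rw [hM.out.add_succ, h, hM.out.add_succ]

theorem add_comm' (m n : M.Num) : m + n = n + m := by
  refine bdd_ind (fun n => m + n = n + m) ?_ (fun n h => ?_) n
  · rw [hM.out.add_zero, zero_add']
  · rw [hM.out.add_succ, h, succ_add']

theorem add_assoc' (m n k : M.Num) : m + n + k = m + (n + k) := by
  refine bdd_ind (fun k => m + n + k = m + (n + k)) ?_ (fun k h => ?_) k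
  · rw [hM.out.add_zero, hM.out.add_zero]
  · rw [hM.out.add_succ, h, hM.out.add_succ, hM.out.add_succ]

theorem zero_mul' (n : M.Num) : 0 * n = 0 := by
  refine bdd_ind (fun n => 0 * n = 0) (hM.out.mul_zero 0) (fun n h => ?_) n
  rw [hM.out.mul_succ, h, hM.out.add_zero]

theorem mul_add' (m n k : M.Num) : m * (n + k) = m * n + m * k := by
  refine bdd_ind (fun k => m * (n + k) = m * n + m * k) ?_ (fun k h => ?_) k
  · rw [hM.out.add_zero, hM.out.mul_zero, hM.out.add_zero]
  · rw [hM.out.add_succ, hM.out.mul_succ, h, hM.out.mul_succ, add_assoc']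

theorem succ_mul' (m n : M.Num) : (m + 1) * n = m * n + n := by
  refine bdd_ind (fun n => (m + 1) * n = m * n + n) ?_ (fun n h => ?_) n
  · rw [hM.out.mul_zero, hM.out.mul_zero, hM.out.add_zero]
  · rw [hM.out.mul_succ, h, hM.out.mul_succ, add_assoc', add_assoc', hM.out.add_succ,
      hM.out.add_succ, hM.out.add_succ, hM.out.add_succ, add_comm' n m]

theorem mul_comm' (m n : M.Num) : m * n = n * m := by
  refine bdd_ind (fun n => m * n = n * m) ?_ (fun n h => ?_) n
  · rw [hM.out.mul_zero, zero_mul']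
  · rw [hM.out.mul_succ, h, succ_mul']

theorem mul_assoc' (m n k : M.Num) : m * n * k = m * (n * k) := by
  refine bdd_ind (fun k => m * n * k = m * (n * k)) ?_ (fun k h => ?_) k
  · rw [hM.out.mul_zero, hM.out.mul_zero, hM.out.mul_zero]
  · rw [hM.out.mul_succ, h, hM.out.mul_succ, mul_add']

instance : CommSemiring M.Num where
  zero := 0
  one := 1
  add := (· + ·)
  mul := (· * ·)
  add_assoc := add_assoc'
  zero_add := zero_add'
  add_zero := hM.out.add_zero
  add_comm := add_comm'
  left_distrib := mul_add'
  right_distrib a b c := by rw [mul_comm', mul_add', mul_comm' c, mul_comm' c]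
  zero_mul := zero_mul'
  mul_zero := hM.out.mul_zero
  mul_assoc := mul_assoc'
  one_mul a := by rw [mul_comm', ← zero_add' 1, hM.out.mul_succ, hM.out.mul_zero, zero_add']
  mul_one a := by rw [← zero_add' 1, hM.out.mul_succ, hM.out.mul_zero, zero_add']
  mul_comm := mul_comm'
  nsmul := nsmulRec

theorem add_right_cancel' (m n k : M.Num) : m + k = n + k → m = n := by
  refine bdd_ind (fun k => m + k = n + k → m = n) ?_ (fun k h h' => ?_) k
  · simp
  · rw [hM.out.add_succ, hM.out.add_succ] at h'
    exact h (hM.out.succ_inj _ _ h')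

theorem lt_add_succ (m k : M.Num) : m < m + (k + 1) := by
  refine bdd_ind (fun k => m < m + (k + 1)) ?_ (fun k h => ?_) k
  · rw [zero_add, hM.out.lt_succ_iff]; exact .inr rfl
  · rw [hM.out.add_succ, hM.out.lt_succ_iff]; exact .inl h

theorem lt_iff_exists (m n : M.Num) : m < n ↔ ∃ k, m + (k + 1) = n := by
  refine ⟨fun h => ?_, fun ⟨k, hk⟩ => hk ▸ lt_add_succ m k⟩
  -- There is no subtraction: the difference is found by `Σ⁰₁` induction, with the implication kept
  -- inside the bounded matrix.
  obtain ⟨k, hk⟩ := sigma_ind (fun k n => m < n → m + (k + 1) = n)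
    ⟨0, fun h => (hM.out.not_lt_zero _ h).elim⟩ (fun n ⟨k, hk⟩ => by
      by_cases h : m < n
      · exact ⟨k + 1, fun _ => by rw [hM.out.add_succ, hk h]⟩
      · exact ⟨0, fun h' => by
          rcases (hM.out.lt_succ_iff _ _).1 h' with h' | rfl
          · exact (h h').elim
          · rw [zero_add]⟩) n
  exact ⟨k, hk h⟩

theorem lt_irrefl' (m : M.Num) : ¬ m < m := fun h => by
  obtain ⟨k, hk⟩ := (lt_iff_exists m m).1 h
  refine hM.out.succ_ne_zero k (add_right_cancel' _ _ m ?_)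
  rw [add_comm, hk, zero_add]

theorem lt_trans' {m n k : M.Num} (h₁ : m < n) (h₂ : n < k) : m < k := by
  obtain ⟨a, rfl⟩ := (lt_iff_exists _ _).1 h₁
  obtain ⟨b, rfl⟩ := (lt_iff_exists _ _).1 h₂
  exact (lt_iff_exists _ _).2 ⟨a + (b + 1), by simp only [add_comm, add_left_comm]⟩

theorem trichotomy (m n : M.Num) : m < n ∨ m = n ∨ n < m := by
  refine bdd_ind (fun n => m < n ∨ m = n ∨ n < m) ?_ (fun n h => ?_) n
  · refine bdd_ind (fun m => m < 0 ∨ m = 0 ∨ 0 < m) (.inr (.inl rfl)) (fun m _ => ?_) m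
    exact .inr (.inr ((lt_iff_exists _ _).2 ⟨m, zero_add _⟩))
  · rcases h with h | rfl | h
    · exact .inl ((hM.out.lt_succ_iff _ _).2 (.inl h))
    · exact .inl ((hM.out.lt_succ_iff _ _).2 (.inr rfl))
    · obtain ⟨k, rfl⟩ := (lt_iff_exists _ _).1 h
      rcases eq_or_ne k 0 with rfl | hk
      · exact .inr (.inl (by rw [zero_add]))
      · have : 0 < k := by
          refine (bdd_ind (fun k => k = 0 ∨ 0 < k) (.inl rfl)
            (fun k _ => .inr ?_) k).resolve_left hk
          exact (lt_iff_exists _ _).2 ⟨k, zero_add _⟩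
        obtain ⟨j, rfl⟩ := (lt_iff_exists _ _).1 this
        refine .inr (.inr ((lt_iff_exists _ _).2 ⟨j, ?_⟩))
        simp only [zero_add, add_comm, add_left_comm]

noncomputable instance : LinearOrder M.Num where
  lt := (· < ·)
  le m n := m < n ∨ m = n
  le_refl m := .inr rfl
  le_trans a b c := by
    rintro (h₁ | rfl) (h₂ | rfl)
    exacts [.inl (lt_trans' h₁ h₂), .inl h₁, .inl h₂, .inr rfl]
  le_antisymm a b := by
    rintro (h₁ | rfl) (h₂ | h₂)
    exacts [(lt_irrefl' _ (lt_trans' h₁ h₂)).elim, h₂.symm, rfl, rfl]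
  le_total a b := by
    rcases trichotomy a b with h | h | h
    exacts [.inl (.inl h), .inl (.inr h), .inr (.inl h)]
  lt_iff_le_not_ge a b := by
    refine ⟨fun h => ⟨.inl h, ?_⟩, fun ⟨h₁, h₂⟩ => h₁.resolve_right fun h => h₂ (.inr h.symm)⟩
    rintro (h' | rfl)
    exacts [lt_irrefl' _ (lt_trans' h h'), lt_irrefl' _ h]
  toDecidableLE := Classical.decRel _

theorem le_iff_lt_or_eq' (m n : M.Num) : m ≤ n ↔ m < n ∨ m = n := Iff.rfl

theorem le_iff_exists (m n : M.Num) : m ≤ n ↔ ∃ k, n = m + k := by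
  rw [le_iff_lt_or_eq', lt_iff_exists]
  constructor
  · rintro (⟨k, rfl⟩ | rfl)
    exacts [⟨k + 1, rfl⟩, ⟨0, (add_zero _).symm⟩]
  · rintro ⟨k, rfl⟩
    rcases trichotomy k 0 with h | rfl | h
    · exact (hM.out.not_lt_zero _ h).elim
    · exact .inr (add_zero _).symm
    · obtain ⟨j, rfl⟩ := (lt_iff_exists _ _).1 h
      exact .inl ⟨j, by rw [zero_add]⟩

instance : IsOrderedCancelAddMonoid M.Num where
  add_le_add_left a b h c := by
    obtain ⟨k, rfl⟩ := (le_iff_exists _ _).1 h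
    exact (le_iff_exists _ _).2 ⟨k, by rw [add_right_comm]⟩
  le_of_add_le_add_left a b c h := by
    obtain ⟨k, hk⟩ := (le_iff_exists _ _).1 h
    refine (le_iff_exists _ _).2 ⟨k, add_right_cancel' _ _ a ?_⟩
    rw [add_comm, hk, add_comm a, add_right_comm]

instance : CanonicallyOrderedAdd M.Num where
  exists_add_of_le h := (le_iff_exists _ _).1 h
  le_self_add _ b := (le_iff_exists _ _).2 ⟨b, rfl⟩
  le_add_self _ b := (le_iff_exists _ _).2 ⟨b, add_comm _ _⟩

instance : Nontrivial M.Num :=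
  ⟨⟨1, 0, fun h => hM.out.succ_ne_zero 0 (by rw [zero_add, h])⟩⟩

instance : IsStrictOrderedRing M.Num where
  zero_le_one := zero_le
  mul_lt_mul_of_pos_left a ha b c h := by
    obtain ⟨i, rfl⟩ := (lt_iff_exists _ _).1 ha
    obtain ⟨j, rfl⟩ := (lt_iff_exists _ _).1 h
    exact (lt_iff_exists _ _).2 ⟨i * j + i + j, by ring⟩
  mul_lt_mul_of_pos_right a ha b c h := by
    obtain ⟨i, rfl⟩ := (lt_iff_exists _ _).1 ha
    obtain ⟨j, rfl⟩ := (lt_iff_exists _ _).1 h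
    exact (lt_iff_exists _ _).2 ⟨i * j + i + j, by ring⟩

theorem lt_succ_iff {m n : M.Num} : m < n + 1 ↔ m ≤ n := hM.out.lt_succ_iff m n

theorem succ_le_iff {m n : M.Num} : m + 1 ≤ n ↔ m < n := by
  rw [← not_lt, lt_succ_iff, not_le]

end Num

/-! ### Least elements and collection -/

instance BddPred.le (f g : (ℕ → M.Num) → M.Num) [BddTerm f] [BddTerm g] :
    BddPred fun e => f e ≤ g e := .congr fun _ => Num.le_iff_lt_or_eq' _ _

theorem bdd_least (P : M.Num → Prop) [hP : BddPred fun e : ℕ → M.Num => P (e 0)] {n : M.Num}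
    (hn : P n) : ∃ m, P m ∧ ∀ k, k < m → ¬ P k := by
  by_contra! h
  have (f : (ℕ → M.Num) → M.Num) [BddTerm f] := hP.subst₁ (P := P) f
  have key := bdd_ind (fun m => ∀ k, k < m → ¬ P k)
    (fun k hk => absurd hk not_lt_zero) fun m hm k hk hk' => by
    rcases (hM.out.lt_succ_iff _ _).1 hk with hk | rfl
    · exact hm k hk hk'
    · obtain ⟨j, hj, hj'⟩ := h k hk'
      exact hm j hj hj'
  exact key (n + 1) n (Num.lt_succ_iff.2 le_rfl) hn

/-- Bounding for `Σ⁰₁` predicates. -/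
theorem collection (Q : M.Num → M.Num → Prop) [hQ : BddPred fun e : ℕ → M.Num => Q (e 0) (e 1)]
    (k : M.Num) (h : ∀ n, n < k → ∃ m, Q m n) : ∃ b, ∀ n, n < k → ∃ m, m < b ∧ Q m n := by
  have (f g : (ℕ → M.Num) → M.Num) [BddTerm f] [BddTerm g] := hQ.subst₂ (P := Q) f g
  obtain ⟨b, hb⟩ := sigma_ind (fun b j => j ≤ k → ∀ n, n < j → ∃ m, m < b ∧ Q m n)
    ⟨0, fun _ n hn => absurd hn not_lt_zero⟩ (fun j ⟨b, hb⟩ => by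
      by_cases hj : j < k
      · obtain ⟨m, hm⟩ := h j hj
        refine ⟨b + (m + 1), fun _ n hn => ?_⟩
        rcases (hM.out.lt_succ_iff _ _).1 hn with hn | rfl
        · obtain ⟨m', h₁, h₂⟩ := hb hj.le n hn
          exact ⟨m', h₁.trans_le le_self_add, h₂⟩
        · exact ⟨m, (Num.lt_succ_iff.2 le_rfl).trans_le le_add_self, hm⟩
      · exact ⟨0, fun h => absurd (Num.succ_le_iff.1 h) hj⟩) k
  exact ⟨b, hb le_rfl⟩

end L2Structure

namespace L2Structure

variable {M : L2Structure.{u}} [hM : Fact M.IsModelRCA₀]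

/-! ### Pairs and codes of finite sets -/

theorem Num.le_mul_self' (a : M.Num) : a ≤ a * a := by
  rcases eq_zero_or_pos a with rfl | h
  · simp
  · exact le_mul_of_one_le_left zero_le (by simpa using Num.succ_le_iff.2 h)

theorem left_le_pair (i j : M.Num) : i ≤ pair i j := le_add_self

theorem right_le_pair (i j : M.Num) : j ≤ pair i j :=
  le_add_self.trans ((Num.le_mul_self' (i + j)).trans le_self_add)

theorem pair_le_pair {i j k l : M.Num} (h₁ : i ≤ k) (h₂ : j ≤ l) : pair i j ≤ pair k l := by
  unfold pair
  gcongr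

/-- With `s = i + j` one has `s² ≤ s² + i < (s + 1)²`, so a code determines the sum of its
components. -/
theorem pair_lt_of_add_lt {i j k l : M.Num} (h : i + j < k + l) : pair i j < pair k l := by
  have h₁ : i + j + 1 ≤ k + l := Num.succ_le_iff.2 h
  calc pair i j < (i + j + 1) * (i + j + 1) := by
        have : (i + j + 1) * (i + j + 1) = pair i j + (i + j + j + 1) := by unfold pair; ring
        rw [this]
        exact lt_of_lt_of_le (Num.lt_succ_iff.2 le_rfl) (add_le_add_right le_add_self _)
    _ ≤ (k + l) * (k + l) := by gcongr
    _ ≤ pair k l := le_self_add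

theorem pair_inj {i j k l : M.Num} : pair i j = pair k l ↔ i = k ∧ j = l := by
  refine ⟨fun h => ?_, fun ⟨h₁, h₂⟩ => h₁ ▸ h₂ ▸ rfl⟩
  rcases lt_trichotomy (i + j) (k + l) with h' | h' | h'
  · exact absurd h (pair_lt_of_add_lt h').ne
  · unfold pair at h
    rw [h'] at h
    obtain rfl := add_left_cancel h
    exact ⟨rfl, add_left_cancel h'⟩
  · exact absurd h (pair_lt_of_add_lt h').ne'

instance BddTerm.pair (f g : (ℕ → M.Num) → M.Num) [BddTerm f] [BddTerm g] :
    BddTerm fun e => pair (f e) (g e) :=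
  inferInstanceAs (BddTerm fun e => (f e + g e) * (f e + g e) + f e)

theorem Num.dvd_iff_bdd (a b : M.Num) : a ∣ b ↔ ∃ q, q < b + 1 ∧ b = a * q := by
  refine ⟨fun ⟨q, hq⟩ => ?_, fun ⟨q, _, hq⟩ => ⟨q, hq⟩⟩
  rcases eq_zero_or_pos a with rfl | h
  · exact ⟨0, by simp, by simpa using hq⟩
  · refine ⟨q, Num.lt_succ_iff.2 ?_, hq⟩
    rw [hq]
    exact le_mul_of_one_le_left zero_le (by simpa using Num.succ_le_iff.2 h)

instance BddPred.dvd (f g : (ℕ → M.Num) → M.Num) [BddTerm f] [BddTerm g] :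
    BddPred fun e => f e ∣ g e := by
  have : BddPred fun e : ℕ → M.Num => e 0 ∣ e 1 := .congr fun e => Num.dvd_iff_bdd (e 0) (e 1)
  exact this.subst₂ (P := fun a b => a ∣ b) f g

theorem inCode_pair {i k m n : M.Num} :
    InCode i (pair k (pair m n)) ↔ i < k ∧ m * (i + 1) + 1 ∣ n := by
  constructor
  · rintro ⟨k', m', n', h, hi, q, hq⟩
    simp only [pair_inj] at h
    obtain ⟨rfl, rfl, rfl⟩ := h
    exact ⟨hi, q, by rw [hq, mul_comm]⟩
  · rintro ⟨hi, q, hq⟩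
    exact ⟨k, m, n, rfl, hi, q, by rw [hq, mul_comm]⟩

theorem inCode_iff_bdd (i c : M.Num) : InCode i c ↔ ∃ k, k < c + 1 ∧ ∃ m, m < c + 1 ∧
    ∃ n, n < c + 1 ∧ c = pair k (pair m n) ∧ i < k ∧ m * (i + 1) + 1 ∣ n := by
  constructor
  · rintro ⟨k, m, n, rfl, hi, q, hq⟩
    refine ⟨k, Num.lt_succ_iff.2 (left_le_pair _ _), m,
      Num.lt_succ_iff.2 ((left_le_pair m n).trans (right_le_pair _ _)), n,
      Num.lt_succ_iff.2 ((right_le_pair m n).trans (right_le_pair _ _)), rfl, hi, q, ?_⟩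
    rw [hq, mul_comm]
  · rintro ⟨k, -, m, -, n, -, rfl, h⟩
    exact inCode_pair.2 h

theorem InCode.lt {i c : M.Num} (h : InCode i c) : i < c := by
  obtain ⟨k, m, n, rfl, hi, -⟩ := h
  exact hi.trans_le (left_le_pair _ _)

instance BddPred.inCode (f g : (ℕ → M.Num) → M.Num) [BddTerm f] [BddTerm g] :
    BddPred fun e => InCode (f e) (g e) := by
  have : BddPred fun e : ℕ → M.Num => InCode (e 0) (e 1) :=
    .congr fun e => inCode_iff_bdd (e 0) (e 1)
  exact this.subst₂ (P := InCode) f g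

/-- A number separating the sets coded by `d < c` lies in one of them and hence below `c`, which
bounds the quantifier over `i`. -/
instance BddPred.isFinCode (f : (ℕ → M.Num) → M.Num) [BddTerm f] :
    BddPred fun e => IsFinCode (f e) := by
  have h (c : M.Num) : IsFinCode c ↔ ∀ d, d < c → ∃ i, i < c ∧ ¬ (InCode i d ↔ InCode i c) := by
    refine forall₂_congr fun d hd => ⟨fun ⟨i, hi⟩ => ⟨i, ?_, hi⟩, fun ⟨i, _, hi⟩ => ⟨i, hi⟩⟩
    by_contra hic
    exact hi ⟨fun h => absurd (h.lt.trans hd) hic, fun h => absurd h.lt hic⟩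
  have : BddPred fun e : ℕ → M.Num => IsFinCode (e 0) := .congr fun e => h (e 0)
  exact this.subst₁ f

/-- `m` and `p` bound the codes of the subsets of `{0, …, b - 1}`: each of them is coded by
`(b, (m, n))` for some `n ≤ p`. -/
def CodeBound (b m p : M.Num) : Prop :=
  0 < m ∧ 0 < p ∧ ∀ i, i < b → i + 1 ∣ m ∧ m * (i + 1) + 1 ∣ p

instance BddPred.codeBound (f g h : (ℕ → M.Num) → M.Num) [BddTerm f] [BddTerm g] [BddTerm h] :
    BddPred fun e => CodeBound (f e) (g e) (h e) := by
  have : BddPred fun e : ℕ → M.Num => CodeBound (e 0) (e 1) (e 2) := by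
    unfold CodeBound
    infer_instance
  exact this.subst₃ f g h

/-- A common multiple of the `i + 1`, and then one of the moduli, is built factor by factor; `Σ⁰₁`
induction replaces the recursion defining a factorial or a product. -/
theorem exists_codeBound (b : M.Num) : ∃ m p, CodeBound b m p := by
  obtain ⟨m, hm, hm'⟩ := sigma_ind (M := M) (fun m b => 0 < m ∧ ∀ i, i < b → i + 1 ∣ m)
    ⟨1, zero_lt_one, fun i hi => absurd hi not_lt_zero⟩ (fun b ⟨m, hm, h⟩ =>
      ⟨m * (b + 1), by positivity, fun i hi => by
        rcases (hM.out.lt_succ_iff _ _).1 hi with hi | rfl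
        · exact (h i hi).mul_right _
        · exact dvd_mul_left _ _⟩) b
  obtain ⟨p, hp, hp'⟩ := sigma_ind (M := M) (fun p b => 0 < p ∧ ∀ i, i < b → m * (i + 1) + 1 ∣ p)
    ⟨1, zero_lt_one, fun i hi => absurd hi not_lt_zero⟩ (fun b ⟨p, hp, h⟩ =>
      ⟨p * (m * (b + 1) + 1), by positivity, fun i hi => by
        rcases (hM.out.lt_succ_iff _ _).1 hi with hi | rfl
        · exact (h i hi).mul_right _
        · exact dvd_mul_left _ _⟩) b
  exact ⟨m, p, hm, hp, fun i hi => ⟨hm' i hi, hp' i hi⟩⟩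

theorem Num.dvd_of_dvd_add {a b c : M.Num} (h : a ∣ b + c) (h' : a ∣ b) : a ∣ c := by
  obtain ⟨x, rfl⟩ := h'
  obtain ⟨y, hy⟩ := h
  rcases eq_zero_or_pos a with rfl | ha
  · simp only [zero_mul, zero_add] at hy
    simp [hy]
  · have : x ≤ y := le_of_mul_le_mul_left (hy ▸ le_self_add) ha
    obtain ⟨z, rfl⟩ := exists_add_of_le this
    exact ⟨z, add_left_cancel (a := a * x) (by rw [hy, mul_add])⟩

/-- The moduli `m (i + 1) + 1` and `m (j + 1) + 1` are coprime if `m` is divisible by the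
difference of `i` and `j`. -/
theorem dvd_of_dvd_modulus_mul {i j d m n : M.Num} (hd : d ∣ m) (hij : i = j + d ∨ j = i + d)
    (h : m * (i + 1) + 1 ∣ (m * (j + 1) + 1) * n) : m * (i + 1) + 1 ∣ n := by
  obtain ⟨t, rfl⟩ := hd
  rcases hij with rfl | rfl
  -- Write `P`, `Q` for the moduli of `i`, `j`. Then `(i + 1) Q` and `(j + 1) P` differ by `d`, and
  -- `d t (i + 1) ≡ -1` modulo `P`. Hence `(i + 1)² t Q n` is congruent to `-n` if `i = j + d` and
  -- to `n` if `j = i + d`; the identities below say this without subtraction.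
  · refine Num.dvd_of_dvd_add
      (b := (j + d + 1) * (j + d + 1) * t * ((d * t * (j + 1) + 1) * n)) ?_ (h.mul_left _)
    exact ⟨n + (j + d + 1) * t * (j + 1) * n, by ring⟩
  · refine Num.dvd_of_dvd_add
      (b := (d * t * (i + 1) + 1) * ((i + 1) * t * (i + d + 1) * n)) ?_ (dvd_mul_right _ _)
    have : (d * t * (i + 1) + 1) * ((i + 1) * t * (i + d + 1) * n) + n =
        (d * t * (i + 1) + 1) * n + (i + 1) * (i + 1) * t * ((d * t * (i + d + 1) + 1) * n) := by
      ring
    rw [this]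
    exact (dvd_mul_right _ _).add (h.mul_left _)

/-- Take the least positive `n` divisible by the moduli of all elements of `X` below `b`. If the
modulus of some `j ∉ X` also divided `n`, dividing it out would give a smaller such `n`, the moduli
being coprime. Minimality also gives `n ≤ p`. -/
theorem CodeBound.exists_code {b m p : M.Num} (h : CodeBound b m p) {X : Set M.Num}
    (hX : X ∈ M.sets) : ∃ n, n ≤ p ∧ ∀ i, InCode i (pair b (pair m n)) ↔ i < b ∧ i ∈ X := by
  have := Fact.mk hX
  obtain ⟨hm, hp, h⟩ := h
  obtain ⟨n, ⟨hn, hnX⟩, hmin⟩ := bdd_least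
    (fun n => 0 < n ∧ ∀ i, i < b → i ∈ X → m * (i + 1) + 1 ∣ n)
    (n := p) ⟨hp, fun i hi _ => (h i hi).2⟩
  refine ⟨n, le_of_not_gt fun hlt => hmin p hlt ⟨hp, fun i hi _ => (h i hi).2⟩, fun j => ?_⟩
  rw [inCode_pair]
  refine and_congr_right fun hj => ⟨fun hjn => ?_, fun hjX => hnX j hj hjX⟩
  by_contra hjX
  obtain ⟨q, rfl⟩ := hjn
  have hq : 0 < q := pos_of_mul_pos_right hn zero_le
  refine hmin q ?_ ⟨hq, fun i hi hiX => ?_⟩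
  · have : 0 < m * (j + 1) := by positivity
    exact (lt_mul_iff_one_lt_left hq).2 (lt_add_of_pos_left 1 this)
  · rcases lt_trichotomy i j with hij | rfl | hij
    · obtain ⟨d, rfl⟩ := (Num.lt_iff_exists _ _).1 hij
      refine dvd_of_dvd_modulus_mul (d := d + 1) (h d ?_).1 (.inr rfl) (hnX i hi hiX)
      exact (Num.succ_le_iff.1 le_add_self).trans hj
    · exact absurd hiX hjX
    · obtain ⟨d, rfl⟩ := (Num.lt_iff_exists _ _).1 hij
      refine dvd_of_dvd_modulus_mul (d := d + 1) (h d ?_).1 (.inl rfl) (hnX _ hi hiX)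
      exact (Num.succ_le_iff.1 le_add_self).trans hi

/-- Every bounded set is coded. -/
theorem exists_finCode {X : Set M.Num} (hX : X ∈ M.sets) {b : M.Num} (hb : ∀ i ∈ X, i < b) :
    ∃ c, IsFinCode c ∧ ∀ i, InCode i c ↔ i ∈ X := by
  have := Fact.mk hX
  obtain ⟨m, p, h⟩ := exists_codeBound b
  obtain ⟨n, -, hn⟩ := h.exists_code hX
  -- Bounded quantifiers in both inclusions make a least code available.
  have key (c : M.Num) : (∀ i, InCode i c ↔ i ∈ X) ↔
      (∀ i, i < c → InCode i c → i ∈ X) ∧ ∀ i, i < b → i ∈ X → InCode i c :=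
    ⟨fun h => ⟨fun i _ => (h i).1, fun i _ => (h i).2⟩,
      fun h i => ⟨fun hi => h.1 i hi.lt hi, fun hi => h.2 i (hb i hi) hi⟩⟩
  obtain ⟨c, hc, hmin⟩ := bdd_least (fun c =>
      (∀ i, i < c → InCode i c → i ∈ X) ∧ ∀ i, i < b → i ∈ X → InCode i c)
    ((key _).1 fun i => (hn i).trans ⟨And.right, fun hi => ⟨hb i hi, hi⟩⟩)
  rw [← key] at hc
  refine ⟨c, fun d hd => ?_, hc⟩
  by_contra! h'
  exact hmin d hd ((key d).1 fun i => (h' i).trans (hc i))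

theorem IsFinCode.eq {c d : M.Num} (hc : IsFinCode c) (hd : IsFinCode d)
    (h : ∀ i, InCode i c ↔ InCode i d) : c = d := by
  rcases lt_trichotomy c d with hlt | h' | hlt
  · obtain ⟨i, hi⟩ := hd c hlt
    exact absurd (h i) hi
  · exact h'
  · obtain ⟨i, hi⟩ := hc d hlt
    exact absurd (h i).symm hi

theorem setOf_inCode_mem (c : M.Num) : {i | InCode i c} ∈ M.sets := setOf_mem (InCode · c)

theorem exists_vec (n : M.Num) {X : Set M.Num} (hX : X ∈ M.sets) :
    ∃ a, IsVec n a ∧ ∀ i, InCode i a ↔ i < n ∧ i ∈ X := by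
  have := Fact.mk hX
  obtain ⟨a, ha, h⟩ := exists_finCode (setOf_mem fun i => i < n ∧ i ∈ X) (b := n) fun i hi => hi.1
  exact ⟨a, ⟨ha, fun i hi => ((h i).1 hi).1⟩, h⟩

theorem IsVec.eq {n a b : M.Num} (ha : IsVec n a) (hb : IsVec n b)
    (h : ∀ i, i < n → (InCode i a ↔ InCode i b)) : a = b :=
  ha.1.eq hb.1 fun i => ⟨fun hi => (h i (ha.2 i hi)).1 hi, fun hi => (h i (hb.2 i hi)).2 hi⟩

end L2Structure

namespace L2Structure

variable {M : L2Structure.{u}}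

instance BddPred.const (p : Prop) : BddPred fun _ : ℕ → M.Num => p := by
  by_cases hp : p
  · exact .congr (P := fun _ => (0 : M.Num) = 0) fun _ => by simp [hp]
  · exact .congr (P := fun _ => ¬ (0 : M.Num) = 0) fun _ => by simp [hp]

/-- `ν`, with the truth values exchanged if `p` is `false`. -/
def polar (p : Bool) (ν : Set M.Num) : Set M.Num := {i | i ∈ ν ↔ p = true}

theorem mem_polar {p : Bool} {ν : Set M.Num} {i : M.Num} : i ∈ polar p ν ↔ (i ∈ ν ↔ p = true) :=
  Iff.rfl

theorem polar_polar (p : Bool) (ν : Set M.Num) : polar p (polar p ν) = ν := by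
  ext i
  cases p <;> simp [mem_polar]

variable [hM : Fact M.IsModelRCA₀]

/-! ### An unbounded `Σ⁰₁` class has an infinite subset -/

/-- The numbers that exceed everything enumerated before them form the required set. It is
unbounded, since the first number above `b` to appear is one of them. -/
theorem exists_infinite_subset (Q : M.Num → M.Num → Prop)
    [hQ : BddPred fun e : ℕ → M.Num => Q (e 0) (e 1)] (h : ∀ b, ∃ x, b < x ∧ ∃ w, Q w x) :
    ∃ H ∈ M.sets, IsInf H ∧ ∀ x ∈ H, ∃ w, Q w x := by
  have (f g : (ℕ → M.Num) → M.Num) [BddTerm f] [BddTerm g] := hQ.subst₂ (P := Q) f g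
  -- `x` is enumerated at stage `t`; it is kept if it exceeds everything enumerated before.
  let En (t x : M.Num) : Prop := ∃ w, w < t + 1 ∧ t = pair x w ∧ Q w x
  let New (t x : M.Num) : Prop :=
    En t x ∧ ∀ t', t' < t → ∀ x', x' < t' + 1 → En t' x' → x' < x
  have hEn : BddPred fun e : ℕ → M.Num => En (e 0) (e 1) := by
    simp only [En]; infer_instance
  have (f g : (ℕ → M.Num) → M.Num) [BddTerm f] [BddTerm g] := hEn.subst₂ (P := En) f g
  have hNew : BddPred fun e : ℕ → M.Num => New (e 0) (e 1) := by
    simp only [New]; infer_instance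
  have (f g : (ℕ → M.Num) → M.Num) [BddTerm f] [BddTerm g] := hNew.subst₂ (P := New) f g
  have hen {x w : M.Num} (hw : Q w x) : En (pair x w) x :=
    ⟨w, Num.lt_succ_iff.2 (right_le_pair _ _), rfl, hw⟩
  have hle {t x : M.Num} (ht : En t x) : x < t + 1 := by
    obtain ⟨w, -, rfl, -⟩ := ht
    exact Num.lt_succ_iff.2 (left_le_pair _ _)
  refine ⟨{x | ∃ t, New t x}, ?_, fun b => ?_, ?_⟩
  -- The `Π⁰₁` form: once something larger than `x` has appeared, `x` can no longer become a record,
  -- so it must have been one already.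
  · refine setOf_exists_mem New (fun t x =>
      (∃ x', x' < t + 1 ∧ En t x' ∧ x < x') → ∃ t', t' < t + 1 ∧ New t' x)
      fun x => ⟨?_, fun hx => ?_⟩
    · rintro ⟨t₀, ht₀⟩ t ⟨x', hx't, hx', hlt⟩
      refine ⟨t₀, Num.lt_succ_iff.2 (le_of_not_gt fun htt => ?_), ht₀⟩
      exact lt_asymm hlt (ht₀.2 t htt x' hx't hx')
    · obtain ⟨x', hlt, w, hw⟩ := h x
      obtain ⟨t, -, ht⟩ := hx _ ⟨x', hle (hen hw), hen hw, hlt⟩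
      exact ⟨t, ht⟩
  · obtain ⟨x', hlt, w, hw⟩ := h b
    obtain ⟨t, ⟨x, -, hx, hbx⟩, hmin⟩ := bdd_least (fun t => ∃ x, x < t + 1 ∧ En t x ∧ b < x)
      (n := pair x' w) ⟨x', hle (hen hw), hen hw, hlt⟩
    refine ⟨x, ⟨t, hx, fun t' ht' x'' hx''t hx'' => ?_⟩, hbx⟩
    by_contra hxx
    exact hmin t' ht' ⟨x'', hx''t, hx'', hbx.trans_le (not_lt.1 hxx)⟩
  · rintro x ⟨t, ⟨w, -, -, hw⟩, -⟩
    exact ⟨w, hw⟩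

/-! ### Assignments -/

theorem empty_mem_sets : (∅ : Set M.Num) ∈ M.sets := by
  simpa using setOf_mem (M := M) fun _ => False

theorem univ_mem_sets : (Set.univ : Set M.Num) ∈ M.sets := by
  simpa using setOf_mem (M := M) fun _ => True

theorem satisfies_pair {ν : Set M.Num} {n r s : M.Num} : Satisfies ν (pair (pair n r) s) ↔
    ∃ a, InCode a r ∧ ∀ i y, InCode (pair i y) s → (InCode i a ↔ y ∈ ν) := by
  constructor
  · rintro ⟨n', r', s', h, ha⟩
    simp only [pair_inj] at h
    obtain ⟨⟨rfl, rfl⟩, rfl⟩ := h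
    exact ha
  · exact fun ha => ⟨n, r, s, rfl, ha⟩

theorem isRel_pair {n r : M.Num} :
    IsRel (pair n r) ↔ IsFinCode r ∧ ∀ a, InCode a r → IsVec n a := by
  constructor
  · rintro ⟨n', r', h, ha⟩
    rw [pair_inj] at h
    obtain ⟨rfl, rfl⟩ := h
    exact ha
  · exact fun ha => ⟨n, r, rfl, ha⟩

theorem IsSeq.lt_of_inCode {n s i y : M.Num} (hs : IsSeq n s) (h : InCode (pair i y) s) :
    i < n := by
  obtain ⟨j, z, hj, hp⟩ := hs.2.1 _ h
  rw [pair_inj] at hp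
  rwa [hp.1]

theorem lt_of_inCode_pair {ρ i y s : M.Num} (h : InCode (pair i y) s) : y < pair ρ s :=
  ((right_le_pair i y).trans_lt h.lt).trans_le (right_le_pair _ _)

/-- The variables of a formula are smaller than its code. So formulas below `d` see an assignment
only below `d`, and coded assignments suffice. -/
theorem Satisfies.congr {ν ν' : Set M.Num} {φ : M.Num} (h : Satisfies ν φ)
    (hν : ∀ y, y < φ → (y ∈ ν ↔ y ∈ ν')) : Satisfies ν' φ := by
  obtain ⟨n, r, s, rfl, a, ha, has⟩ := h
  exact ⟨n, r, s, rfl, a, ha, fun i y hy => (has i y hy).trans (hν y (lt_of_inCode_pair hy))⟩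

/-- The vector of the values of an assignment on a sequence of variables. -/
theorem IsSeq.exists_vec {n s : M.Num} (hs : IsSeq n s) {ν : Set M.Num} (hν : ν ∈ M.sets) :
    ∃ a, IsVec n a ∧ ∀ i y, InCode (pair i y) s → (InCode i a ↔ y ∈ ν) := by
  have := Fact.mk hν
  obtain ⟨a, ha, h⟩ := L2Structure.exists_vec n
    (setOf_mem fun i => ∃ y, y < s ∧ InCode (pair i y) s ∧ y ∈ ν)
  refine ⟨a, ha, fun i y hy => ?_⟩
  rw [h]
  constructor
  · rintro ⟨hi, z, -, hz, hzν⟩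
    rwa [(hs.2.2 i hi).unique hy hz]
  · exact fun hyν => ⟨hs.lt_of_inCode hy, y, (right_le_pair i y).trans_lt hy.lt, hy, hyν⟩

theorem satisfies_iff_inCode {n r s a : M.Num} {ν : Set M.Num} (hr : IsRel (pair n r))
    (hs : IsSeq n s) (ha : IsVec n a) (h : ∀ i y, InCode (pair i y) s → (InCode i a ↔ y ∈ ν)) :
    Satisfies ν (pair (pair n r) s) ↔ InCode a r := by
  rw [satisfies_pair]
  refine ⟨fun ⟨b, hb, hbν⟩ => ?_, fun h' => ⟨a, h', h⟩⟩
  rwa [ha.eq ((isRel_pair.1 hr).2 b hb) fun i hi => ?_]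
  obtain ⟨y, hy, -⟩ := hs.2.2 i hi
  exact (h i y hy).trans (hbν i y hy).symm

theorem polar_mem_sets (p : Bool) {ν : Set M.Num} (hν : ν ∈ M.sets) : polar p ν ∈ M.sets := by
  have := Fact.mk hν
  exact setOf_mem fun i => i ∈ ν ↔ p = true

instance BddPred.satisfies_polar (p : Bool) (f g : (ℕ → M.Num) → M.Num) [BddTerm f] [BddTerm g] :
    BddPred fun e => Satisfies (polar p {i | InCode i (f e)}) (g e) := by
  have key (c φ : M.Num) : Satisfies (polar p {i | InCode i c}) φ ↔ ∃ n, n < φ + 1 ∧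
      ∃ r, r < φ + 1 ∧ ∃ s, s < φ + 1 ∧ φ = pair (pair n r) s ∧ ∃ a, a < r ∧ InCode a r ∧
        ∀ i, i < s → ∀ y, y < s → InCode (pair i y) s →
          (InCode i a ↔ (InCode y c ↔ p = true)) := by
    constructor
    · rintro ⟨n, r, s, rfl, a, ha, h⟩
      refine ⟨n, Num.lt_succ_iff.2 ((left_le_pair n r).trans (left_le_pair _ _)), r,
        Num.lt_succ_iff.2 ((right_le_pair n r).trans (left_le_pair _ _)), s,
        Num.lt_succ_iff.2 (right_le_pair _ _), rfl, a, ha.lt, ha, fun i _ y _ => h i y⟩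
    · rintro ⟨n, -, r, -, s, -, rfl, a, -, ha, h⟩
      exact ⟨n, r, s, rfl, a, ha, fun i y hy => h i ((left_le_pair i y).trans_lt hy.lt) y
        ((right_le_pair i y).trans_lt hy.lt) hy⟩
  have : BddPred fun e : ℕ → M.Num => Satisfies (polar p {i | InCode i (e 0)}) (e 1) :=
    .congr fun e => key (e 0) (e 1)
  exact this.subst₂ (P := fun c φ => Satisfies (polar p {i | InCode i c}) φ) f g

theorem FinSatisfiable.exists_sat {C : Set M.Num} (hC : C ∈ M.sets) (h : FinSatisfiable C)
    (d : M.Num) : ∃ ν ∈ M.sets, ∀ φ ∈ C, φ < d → Satisfies ν φ := by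
  have := Fact.mk hC
  obtain ⟨ν, hν, h'⟩ := h {φ | φ ∈ C ∧ φ < d}
    ⟨setOf_mem fun φ => φ ∈ C ∧ φ < d, d, fun φ hφ => hφ.2⟩ fun φ hφ => hφ.1
  exact ⟨ν, hν, fun φ hφ hd => h' φ ⟨hφ, hd⟩⟩

/-! ### Homogeneous sets from least models -/

/-- `polar p ν` satisfies the members of `C` below `d`. -/
def IsModelBelow (p : Bool) (C : Set M.Num) (d : M.Num) (ν : Set M.Num) : Prop :=
  ∀ φ, φ < d → φ ∈ C → Satisfies (polar p ν) φ

theorem IsModelBelow.mono {p : Bool} {C : Set M.Num} {d d' : M.Num}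
    {ν : Set M.Num} (h : IsModelBelow p C d ν) (hd : d' ≤ d) : IsModelBelow p C d' ν :=
  fun φ hφ => h φ (hφ.trans_le hd)

theorem IsModelBelow.congr {p : Bool} {C : Set M.Num} {d : M.Num} {ν ν' : Set M.Num}
    (h : IsModelBelow p C d ν) (hν : ∀ y, y < d → (y ∈ ν ↔ y ∈ ν')) : IsModelBelow p C d ν' :=
  fun φ hφ hC => (h φ hφ hC).congr fun y hy => by simp only [mem_polar, hν y (hy.trans hφ)]

instance BddPred.isModelBelow (p : Bool) (C : Set M.Num) [Fact (C ∈ M.sets)]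
    (f g : (ℕ → M.Num) → M.Num) [BddTerm f] [BddTerm g] :
    BddPred fun e => IsModelBelow p C (f e) {i | InCode i (g e)} := by
  have : BddPred fun e : ℕ → M.Num => IsModelBelow p C (e 0) {i | InCode i (e 1)} := by
    unfold IsModelBelow
    infer_instance
  exact this.subst₂ (P := fun d c => IsModelBelow p C d {i | InCode i c}) f g

/-- Every model of the members of `C` below `d` contains `x`; a bounded statement because the models
are represented by their codes. -/
def Forced (p : Bool) (C : Set M.Num) (d m q x : M.Num) : Prop :=
  CodeBound d m q ∧ x < d ∧ ∀ n, n < q + 1 →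
    IsModelBelow p C d {i | InCode i (pair d (pair m n))} → InCode x (pair d (pair m n))

/-- Only the part of a model below `d` matters, and `CodeBound` supplies a code `(d, (m, n))` with
`n ≤ q` for it. -/
theorem forced_iff {p : Bool} {C : Set M.Num} {d m q x : M.Num} (h : CodeBound d m q) :
    Forced p C d m q x ↔ x < d ∧ ∀ ν ∈ M.sets, IsModelBelow p C d ν → x ∈ ν := by
  constructor
  · refine fun ⟨_, hx, hF⟩ => ⟨hx, fun ν hν hmod => ?_⟩
    obtain ⟨n, hn, hnν⟩ := h.exists_code hν
    refine ((hnν x).1 (hF n (Num.lt_succ_iff.2 hn) (hmod.congr fun y hy => ?_))).2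
    simp [hnν, hy]
  · exact fun ⟨hx, hF⟩ => ⟨h, hx, fun n _ hmod => hF _ (setOf_inCode_mem _) hmod⟩

/-- The case distinction is whether, for some `b`, models of arbitrarily long initial parts of `C`
can avoid `L` above `b`. If not, each `b` has a `d` for which even the least model contains an
element of `L` above `b`, and that element is forced. -/
theorem exists_homogeneous_of_least_models (p : Bool) {C L : Set M.Num} (hC : C ∈ M.sets)
    (hL : L ∈ M.sets) (hLinf : IsInf L) (hsat : FinSatisfiable C)
    (hleast : ∀ d, ∀ N ∈ M.sets,
      (∀ x, x < d → (x ∈ N ↔ ∀ ν ∈ M.sets, IsModelBelow p C d ν → x ∈ ν)) →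
        IsModelBelow p C d N) :
    ∃ H ∈ M.sets, H ⊆ L ∧ IsInf H ∧ IsHomogeneous C H := by
  have := Fact.mk hC
  have := Fact.mk hL
  have hmodel (d : M.Num) : ∃ ν ∈ M.sets, IsModelBelow p C d ν := by
    obtain ⟨ν, hν, h⟩ := hsat.exists_sat hC d
    refine ⟨polar p ν, polar_mem_sets p hν, fun φ hφ hφC => ?_⟩
    rw [polar_polar]
    exact h φ hφC hφ
  by_cases hb : ∃ b, ∀ d, ∃ ν ∈ M.sets, IsModelBelow p C d ν ∧ ∀ x ∈ L, b < x → x ∉ ν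
  · obtain ⟨b, hb⟩ := hb
    refine ⟨{x | x ∈ L ∧ b < x}, setOf_mem fun x => x ∈ L ∧ b < x, fun x hx => hx.1, fun a => ?_,
      !p, fun D ⟨_, d, hd⟩ hDC => ?_⟩
    · obtain ⟨x, hx, hlt⟩ := hLinf (a + b)
      exact ⟨x, ⟨hx, le_add_self.trans_lt hlt⟩, le_self_add.trans_lt hlt⟩
    · obtain ⟨ν, hν, hmod, hνL⟩ := hb d
      refine ⟨polar p ν, polar_mem_sets p hν, fun φ hφ => hmod φ (hd φ hφ) (hDC hφ),
        fun x hx => ?_⟩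
      rw [mem_polar]
      have := hνL x hx.1 hx.2
      cases p <;> simp [this]
  · push Not at hb
    have hForced : BddPred fun e : ℕ → M.Num =>
        ∃ d, d < e 0 ∧ ∃ m, m < e 0 ∧ ∃ q, q < e 0 ∧ Forced p C d m q (e 1) := by
      unfold Forced
      infer_instance
    let Q (w x : M.Num) : Prop := ∃ d, d < w ∧ ∃ m, m < w ∧ ∃ q, q < w ∧ Forced p C d m q x
    have (f g : (ℕ → M.Num) → M.Num) [BddTerm f] [BddTerm g] := hForced.subst₂ (P := Q) f g
    obtain ⟨H, hH, hHinf, hHQ⟩ := exists_infinite_subset (fun w x => x ∈ L ∧ Q w x) fun b => by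
      obtain ⟨d, hd⟩ := hb b
      obtain ⟨m, q, hdmq⟩ := exists_codeBound d
      have : BddPred fun e : ℕ → M.Num => Forced p C d m q (e 0) := by
        unfold Forced
        infer_instance
      have hN := setOf_mem (fun x => Forced p C d m q x)
      obtain ⟨x, hxL, hbx, hxN⟩ := hd _ hN (hleast d _ hN fun x hx => by
        change Forced p C d m q x ↔ _
        rw [forced_iff hdmq, and_iff_right hx])
      refine ⟨x, hbx, d + m + q + 1, hxL, d, Num.lt_succ_iff.2 (le_self_add.trans le_self_add), m,
        Num.lt_succ_iff.2 (le_add_self.trans le_self_add), q, Num.lt_succ_iff.2 le_add_self, hxN⟩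
    have := Fact.mk hH
    refine ⟨H, hH, fun x hx => (hHQ x hx).choose_spec.1, hHinf, p, fun D ⟨_, b, hDb⟩ hDC => ?_⟩
    -- One bound `B` works for all elements of `H` below `b`: every model of the formulas below `B`
    -- contains them.
    obtain ⟨B, hB⟩ := collection (fun w x => x ∈ H → Q w x) b fun x _ => by
      by_cases hx : x ∈ H
      · obtain ⟨w, -, hw⟩ := hHQ x hx
        exact ⟨w, fun _ => hw⟩
      · exact ⟨0, fun h => absurd h hx⟩
    obtain ⟨ν, hν, hmod⟩ := hmodel (B + b)
    have := Fact.mk hν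
    have hHν : ∀ x, x < b → x ∈ H → x ∈ ν := fun x hxb hx => by
      obtain ⟨w, hwB, hw⟩ := hB x hxb
      obtain ⟨d, hdw, m, -, q, -, hF⟩ := hw hx
      exact ((forced_iff hF.1).1 hF).2 ν hν (hmod.mono ((hdw.trans hwB).le.trans le_self_add))
    -- Adding the rest of `H` changes `ν` only from `b` on, where the formulas of `D` have no
    -- variables.
    refine ⟨polar p {x | x ∈ ν ∨ x ∈ H}, polar_mem_sets p (setOf_mem fun x => x ∈ ν ∨ x ∈ H),
      fun φ hφ => ?_, fun x hx => by simp [mem_polar, hx]⟩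
    refine (hmod.mono le_add_self).congr (d := b) (fun y hy => ?_) φ (hDb φ hφ) (hDC hφ)
    exact ⟨.inl, fun h => h.elim id (hHν y hy)⟩

end L2Structure

namespace L2Structure

variable {M : L2Structure.{u}} [hM : Fact M.IsModelRCA₀]

/-! ### Horn and co-horn relations -/

/-- The vector coded by `a` satisfies the clause with literals `i = p` for `i ∈ U` and `i ≠ p` for
`i ∈ W`. -/
def PolarClauseHolds (p : Bool) (U W : Set M.Num) (a : M.Num) : Prop :=
  (∃ i ∈ U, (InCode i a ↔ p = true)) ∨ ∃ i ∈ W, ¬ (InCode i a ↔ p = true)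

/-- The relation `(n, r)` is defined by clauses which have at most one literal of the form
`i = p`. -/
def PolarHorn (p : Bool) (n r : M.Num) : Prop :=
  ∃ F : Set (Set M.Num × Set M.Num),
    (∀ c ∈ F, c.1.Subsingleton ∧ (∀ i ∈ c.1, i < n) ∧ ∀ i ∈ c.2, i < n) ∧
      ∀ a, IsVec n a → (InCode a r ↔ ∀ c ∈ F, PolarClauseHolds p c.1 c.2 a)

theorem RelHorn.polarHorn {n r : M.Num} (h : RelHorn (pair n r)) : PolarHorn true n r := by
  obtain ⟨n', r', hnr, f, hf, hr⟩ := h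
  rw [pair_inj] at hnr
  obtain ⟨rfl, rfl⟩ := hnr
  refine ⟨{c | ∃ k l, InCode (pair k l) f ∧ c = ({i | InCode i k}, {i | InCode i l})}, ?_,
    fun a ha => ?_⟩
  · rintro _ ⟨k, l, hkl, rfl⟩
    obtain ⟨⟨k', l', h, hk, hl⟩, k'', l'', h', hsub⟩ := hf _ hkl
    rw [pair_inj] at h h'
    obtain ⟨rfl, rfl⟩ := h
    obtain ⟨rfl, rfl⟩ := h'
    exact ⟨fun i hi j hj => hsub i j hi hj, hk, hl⟩
  · rw [hr a ha]
    constructor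
    · rintro h _ ⟨k, l, hkl, rfl⟩
      obtain ⟨k', l', h', hc⟩ := h _ hkl
      rw [pair_inj] at h'
      obtain ⟨rfl, rfl⟩ := h'
      simpa [PolarClauseHolds] using hc
    · intro h c hc
      obtain ⟨⟨k, l, rfl, -⟩, -⟩ := hf c hc
      have := h _ ⟨k, l, hc, rfl⟩
      exact ⟨k, l, rfl, by simpa [PolarClauseHolds] using this⟩

/-- Exchanging truth values turns negative literals into positive ones, so the two literal sets
trade places. -/
theorem RelCoHorn.polarHorn {n r : M.Num} (h : RelCoHorn (pair n r)) : PolarHorn false n r := by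
  obtain ⟨n', r', hnr, f, hf, hr⟩ := h
  rw [pair_inj] at hnr
  obtain ⟨rfl, rfl⟩ := hnr
  refine ⟨{c | ∃ k l, InCode (pair k l) f ∧ c = ({i | InCode i l}, {i | InCode i k})}, ?_,
    fun a ha => ?_⟩
  · rintro _ ⟨k, l, hkl, rfl⟩
    obtain ⟨⟨k', l', h, hk, hl⟩, k'', l'', h', hsub⟩ := hf _ hkl
    rw [pair_inj] at h h'
    obtain ⟨rfl, rfl⟩ := h
    obtain ⟨rfl, rfl⟩ := h'
    exact ⟨fun i hi j hj => hsub i j hi hj, hl, hk⟩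
  · rw [hr a ha]
    constructor
    · rintro h _ ⟨k, l, hkl, rfl⟩
      obtain ⟨k', l', h', hc⟩ := h _ hkl
      rw [pair_inj] at h'
      obtain ⟨rfl, rfl⟩ := h'
      simpa [PolarClauseHolds, or_comm] using hc
    · intro h c hc
      obtain ⟨⟨k, l, rfl, -⟩, -⟩ := hf c hc
      have := h _ ⟨k, l, hc, rfl⟩
      exact ⟨k, l, rfl, by simpa [PolarClauseHolds, or_comm] using this⟩

/-- The intersection of all models of a set of horn formulas is a model. -/
theorem isModelBelow_inter (p : Bool) {S V C : Set M.Num} (hC : C ∈ M.sets)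
    (hform : ∀ φ ∈ C, IsFormulaOver S V φ) (hS : ∀ n r, pair n r ∈ S → PolarHorn p n r)
    (hsat : FinSatisfiable C) {d : M.Num} {N : Set M.Num} (hN : N ∈ M.sets)
    (h : ∀ x, x < d → (x ∈ N ↔ ∀ ν ∈ M.sets, IsModelBelow p C d ν → x ∈ ν)) :
    IsModelBelow p C d N := by
  intro φ hφ hφC
  obtain ⟨n, r, s, rfl, hnr, hrel, hs, -⟩ := hform φ hφC
  obtain ⟨F, hF, hr⟩ := hS n r hnr
  obtain ⟨a, ha, haN⟩ := hs.exists_vec (polar_mem_sets p hN)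
  rw [satisfies_iff_inCode hrel hs ha haN, hr a ha]
  intro c hc
  obtain ⟨hsub, hU, hW⟩ := hF c hc
  have hval {ν : Set M.Num} {b : M.Num} (hb : ∀ i y, InCode (pair i y) s →
      (InCode i b ↔ y ∈ polar p ν)) {i y : M.Num} (hy : InCode (pair i y) s) :
      (InCode i b ↔ p = true) ↔ y ∈ ν := by
    rw [hb i y hy, mem_polar]
    tauto
  have hclause {ν : Set M.Num} (hν : ν ∈ M.sets) (hmod : IsModelBelow p C d ν) :
      (∃ i ∈ c.1, ∃ y, InCode (pair i y) s ∧ y ∈ ν) ∨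
        ∃ i ∈ c.2, ∃ y, InCode (pair i y) s ∧ y ∉ ν := by
    obtain ⟨b, hb, hbν⟩ := hs.exists_vec (polar_mem_sets p hν)
    have hbr := (satisfies_iff_inCode hrel hs hb hbν).1 (hmod _ hφ hφC)
    rcases (hr b hb).1 hbr c hc with ⟨i, hi, hib⟩ | ⟨i, hi, hib⟩
    · obtain ⟨y, hy, -⟩ := hs.2.2 i (hU i hi)
      exact .inl ⟨i, hi, y, hy, (hval hbν hy).1 hib⟩
    · obtain ⟨y, hy, -⟩ := hs.2.2 i (hW i hi)
      exact .inr ⟨i, hi, y, hy, fun h => hib ((hval hbν hy).2 h)⟩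
  -- If the clause fails at `N`, the variables of its literals `i ≠ p` lie in `N`, hence in every
  -- model. So every model satisfies the clause through its only literal `i = p`; but its variable
  -- is not in `N` and is missing from some model. If there is no such literal, the mere existence
  -- of a model is contradictory.
  by_contra hnot
  unfold PolarClauseHolds at hnot
  push Not at hnot
  have hlt {i y : M.Num} (hy : InCode (pair i y) s) : y < d := (lt_of_inCode_pair hy).trans hφ
  have hWN {i y : M.Num} (hi : i ∈ c.2) (hy : InCode (pair i y) s) {ν : Set M.Num}
      (hν : ν ∈ M.sets) (hmod : IsModelBelow p C d ν) : y ∈ ν :=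
    (h y (hlt hy)).1 ((hval haN hy).1 (hnot.2 i hi)) ν hν hmod
  by_cases hne : ∃ j, j ∈ c.1
  · obtain ⟨j, hj⟩ := hne
    obtain ⟨y, hy, hyu⟩ := hs.2.2 j (hU j hj)
    have hyN : y ∉ N := fun hyN => by
      have := hnot.1 j hj
      have := (hval haN hy).2 hyN
      tauto
    rw [h y (hlt hy)] at hyN
    push Not at hyN
    obtain ⟨ν, hν, hmod, hyν⟩ := hyN
    rcases hclause hν hmod with ⟨i, hi, z, hz, hzν⟩ | ⟨i, hi, z, hz, hzν⟩
    · obtain rfl := hsub hi hj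
      exact hyν (hyu z hz ▸ hzν)
    · exact hzν (hWN hi hz hν hmod)
  · obtain ⟨ν, hν, hmod⟩ := hsat.exists_sat hC d
    have hmod' : IsModelBelow p C d (polar p ν) := fun ψ hψ hψC => by
      rw [polar_polar]
      exact hmod ψ hψC hψ
    rcases hclause (polar_mem_sets p hν) hmod' with ⟨i, hi, -⟩ | ⟨i, hi, z, hz, hzν⟩
    · exact hne ⟨i, hi⟩
    · exact hzν (hWN hi hz (polar_mem_sets p hν) hmod')

theorem lrsat_of_polarHorn (p : Bool) {S : Set M.Num}
    (hS : ∀ n r, pair n r ∈ S → PolarHorn p n r) : M.LRSAT S :=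
  fun _ _ _ hC _ hL _ _ hLinf hform hsat =>
    exists_homogeneous_of_least_models p hC hL hLinf hsat fun _ _ hN h =>
      isModelBelow_inter p hC hform hS hsat hN h

theorem lrsat_of_relTame {S : Set M.Num} (hS : RelTame S) : M.LRSAT S := by
  rcases hS with hS | hS | hS | hS
  · intro V _ C _ L hL _ _ hLinf hform _
    refine ⟨L, hL, subset_rfl, hLinf, false, fun D _ hD => ⟨∅, empty_mem_sets, fun φ hφ => ?_,
      by simp⟩⟩
    obtain ⟨n, r, s, rfl, hnr, -, hs, -⟩ := hform φ (hD hφ)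
    obtain ⟨n', r', h, a, ha, ha'⟩ := hS _ hnr
    rw [pair_inj] at h
    obtain ⟨rfl, rfl⟩ := h
    exact satisfies_pair.2 ⟨a, ha, fun i y hy => by simpa using ha' i (hs.lt_of_inCode hy)⟩
  · intro V _ C _ L hL _ _ hLinf hform _
    refine ⟨L, hL, subset_rfl, hLinf, true, fun D _ hD => ⟨_, univ_mem_sets, fun φ hφ => ?_,
      by simp⟩⟩
    obtain ⟨n, r, s, rfl, hnr, -, hs, -⟩ := hform φ (hD hφ)
    obtain ⟨n', r', h, a, ha, ha'⟩ := hS _ hnr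
    rw [pair_inj] at h
    obtain ⟨rfl, rfl⟩ := h
    exact satisfies_pair.2 ⟨a, ha, fun i y hy => by simpa using ha' i (hs.lt_of_inCode hy)⟩
  · exact lrsat_of_polarHorn true fun n r h => (hS _ h).polarHorn
  · exact lrsat_of_polarHorn false fun n r h => (hS _ h).polarHorn

/-! ### Closure properties of horn and co-horn relations -/

/-- The relation coded by `r` is closed under the coordinatewise minimum if `p` is `true`, and under
the coordinatewise maximum if `p` is `false`. -/
def PolarClosed (p : Bool) (n r : M.Num) : Prop :=
  ∀ a b c, InCode a r → InCode b r → IsVec n c →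
    (∀ i, i < n → ((InCode i c ↔ p = true) ↔ (InCode i a ↔ p = true) ∧ (InCode i b ↔ p = true))) →
      InCode c r

theorem PolarHorn.polarClosed {p : Bool} {n r : M.Num} (h : PolarHorn p n r)
    (hrel : IsRel (pair n r)) : PolarClosed p n r := by
  intro a b c ha hb hc habc
  obtain ⟨F, hF, hr⟩ := h
  rw [hr c hc]
  intro C hC
  obtain ⟨hsub, hU, hW⟩ := hF C hC
  have h₁ := (hr a ((isRel_pair.1 hrel).2 a ha)).1 ha C hC
  have h₂ := (hr b ((isRel_pair.1 hrel).2 b hb)).1 hb C hC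
  rcases h₁ with ⟨i, hi, hia⟩ | ⟨i, hi, hia⟩
  · rcases h₂ with ⟨j, hj, hjb⟩ | ⟨j, hj, hjb⟩
    · obtain rfl := hsub hi hj
      exact .inl ⟨i, hi, (habc i (hU i hi)).2 ⟨hia, hjb⟩⟩
    · exact .inr ⟨j, hj, fun h => hjb ((habc j (hW j hj)).1 h).2⟩
  · exact .inr ⟨i, hi, fun h => hia ((habc i (hW i hi)).1 h).1⟩

/-- A vector which is not separated from the closed relation `r` by a clause with at most one
literal of the form `i = p` belongs to `r`. -/
theorem PolarClosed.inCode {p : Bool} {n r a : M.Num} (h : PolarClosed p n r)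
    (hrel : IsRel (pair n r)) (ha : IsVec n a)
    (h₀ : ∃ b, InCode b r ∧ ∀ i, i < n → (InCode i a ↔ p = true) → (InCode i b ↔ p = true))
    (h₁ : ∀ j, j < n → ¬ (InCode j a ↔ p = true) → ∃ b, InCode b r ∧
      (∀ i, i < n → (InCode i a ↔ p = true) → (InCode i b ↔ p = true)) ∧
        ¬ (InCode j b ↔ p = true)) : InCode a r := by
  let Above (b : M.Num) : Prop :=
    ∀ i, i < n → (InCode i a ↔ p = true) → (InCode i b ↔ p = true)
  have hAbove : BddPred fun e : ℕ → M.Num => Above (e 0) := by simp only [Above]; infer_instance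
  have (f : (ℕ → M.Num) → M.Num) [BddTerm f] := hAbove.subst₁ (P := Above) f
  -- The polar minimum of all elements of `r` above `a`, formed one element at a time by bounded
  -- induction. By `h₁` it has no coordinate equal to `p` beyond those of `a`, so it is `a`.
  have key : ∃ c, c < r ∧ InCode c r ∧ Above c ∧ ∀ b, b < r → InCode b r → Above b →
      ∀ i, i < n → (InCode i c ↔ p = true) → (InCode i b ↔ p = true) := by
    refine bdd_ind (fun k => ∃ c, c < r ∧ InCode c r ∧ Above c ∧ ∀ b, b < k → InCode b r →
      Above b → ∀ i, i < n → (InCode i c ↔ p = true) → (InCode i b ↔ p = true)) ?_ ?_ r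
    · obtain ⟨b, hb, hab⟩ := h₀
      exact ⟨b, hb.lt, hb, hab, fun _ h => absurd h not_lt_zero⟩
    rintro k ⟨c, -, hc, hac, hmin⟩
    by_cases hk : InCode k r ∧ Above k
    · have := setOf_mem (M := M) fun i => (InCode i c ↔ p = true) ∧ (InCode i k ↔ p = true)
      obtain ⟨d, hd, hdi⟩ := exists_vec n (polar_mem_sets p this)
      have hdi' (i : M.Num) (hi : i < n) : (InCode i d ↔ p = true) ↔
          (InCode i c ↔ p = true) ∧ (InCode i k ↔ p = true) := by
        rw [hdi i, and_iff_right hi, mem_polar]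
        change ((((InCode i c ↔ p = true) ∧ (InCode i k ↔ p = true)) ↔ p = true) ↔ p = true) ↔ _
        tauto
      have hdr := h c k d hc hk.1 hd hdi'
      refine ⟨d, hdr.lt, hdr, fun i hi hia => (hdi' i hi).2 ⟨hac i hi hia, hk.2 i hi hia⟩,
        fun b hb hbr hab i hi hid => ?_⟩
      rcases (hM.out.lt_succ_iff _ _).1 hb with hb | rfl
      · exact hmin b hb hbr hab i hi ((hdi' i hi).1 hid).1
      · exact ((hdi' i hi).1 hid).2
    · refine ⟨c, hc.lt, hc, hac, fun b hb hbr hab => ?_⟩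
      rcases (hM.out.lt_succ_iff _ _).1 hb with hb | rfl
      · exact hmin b hb hbr hab
      · exact absurd ⟨hbr, hab⟩ hk
  obtain ⟨c, -, hc, hac, hmin⟩ := key
  rwa [ha.eq ((isRel_pair.1 hrel).2 c hc) fun i hi => ?_]
  have : (InCode i a ↔ p = true) ↔ (InCode i c ↔ p = true) := by
    refine ⟨hac i hi, fun hic => ?_⟩
    by_contra hia
    obtain ⟨b, hb, hab, hib⟩ := h₁ i hi hia
    exact hib (hmin b hb.lt hb hab i hi hic)
  tauto

end L2Structure

/-! ### Closed relations are defined by coded sets of clauses -/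

namespace L2Structure

variable {M : L2Structure.{u}} [hM : Fact M.IsModelRCA₀]

theorem clauseHolds_pair {k l a : M.Num} : ClauseHolds (pair k l) a ↔
    (∃ i, InCode i k ∧ InCode i a) ∨ ∃ i, InCode i l ∧ ¬ InCode i a := by
  constructor
  · rintro ⟨k', l', h, ha⟩
    rw [pair_inj] at h
    obtain ⟨rfl, rfl⟩ := h
    exact ha
  · exact fun ha => ⟨k, l, rfl, ha⟩

/-- The clauses of the given polarity that hold for all elements of `r`, as a coded set. -/
theorem exists_clauses (p : Bool) (n r : M.Num) : ∃ f,
    (∀ c, InCode c f → IsClause n c ∧ (p = true → HornClause c) ∧ (p = false → CoHornClause c) ∧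
      ∀ b, InCode b r → ClauseHolds c b) ∧
    ∀ U ∈ M.sets, ∀ W ∈ M.sets, U.Subsingleton → (∀ i ∈ U, i < n) → (∀ i ∈ W, i < n) →
      (∀ b, InCode b r → PolarClauseHolds p U W b) →
        ∃ c, InCode c f ∧ ∀ a, ClauseHolds c a → PolarClauseHolds p U W a := by
  obtain ⟨m, q, hq⟩ := exists_codeBound n
  -- Every set of literals has a code below `K`, so the clauses under consideration form a bounded
  -- set.
  let K := pair n (pair m q) + 1
  let Good (k l : M.Num) : Prop :=
    (∀ i, i < k → InCode i k → i < n) ∧ (∀ i, i < l → InCode i l → i < n) ∧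
    (p = true → ∀ i, i < k → ∀ j, j < k → InCode i k → InCode j k → i = j) ∧
    (p = false → ∀ i, i < l → ∀ j, j < l → InCode i l → InCode j l → i = j) ∧
    ∀ b, b < r → InCode b r →
      (∃ i, i < k ∧ InCode i k ∧ InCode i b) ∨ ∃ i, i < l ∧ InCode i l ∧ ¬ InCode i b
  have hGood : BddPred fun e : ℕ → M.Num => Good (e 0) (e 1) := by
    simp only [Good]; infer_instance
  have (f g : (ℕ → M.Num) → M.Num) [BddTerm f] [BddTerm g] := hGood.subst₂ (P := Good) f g
  obtain ⟨f, -, hf⟩ := exists_finCode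
    (setOf_mem fun c => ∃ k, k < K ∧ ∃ l, l < K ∧ c = pair k l ∧ Good k l) (b := pair K K + 1) (by
      rintro _ ⟨k, hk, l, hl, rfl, -⟩
      exact Num.lt_succ_iff.2 (pair_le_pair hk.le hl.le))
  have hcode {X : Set M.Num} (hX : X ∈ M.sets) (hXn : ∀ i ∈ X, i < n) :
      ∃ k, k < K ∧ ∀ i, InCode i k ↔ i ∈ X := by
    obtain ⟨k, hk, hkX⟩ := hq.exists_code hX
    exact ⟨_, Num.lt_succ_iff.2 (pair_le_pair le_rfl (pair_le_pair le_rfl hk)),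
      fun i => (hkX i).trans ⟨And.right, fun hi => ⟨hXn i hi, hi⟩⟩⟩
  refine ⟨f, fun c hc => ?_, fun U hU W hW hsub hUn hWn hr => ?_⟩
  · obtain ⟨k, -, l, -, rfl, hk, hl, hk', hl', hr⟩ := (hf c).1 hc
    refine ⟨⟨k, l, rfl, fun i hi => hk i hi.lt hi, fun i hi => hl i hi.lt hi⟩,
      fun hp => ⟨k, l, rfl, fun i j hi hj => hk' hp i hi.lt j hj.lt hi hj⟩,
      fun hp => ⟨k, l, rfl, fun i j hi hj => hl' hp i hi.lt j hj.lt hi hj⟩, fun b hb => ?_⟩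
    rw [clauseHolds_pair]
    exact (hr b hb.lt hb).imp (fun ⟨i, _, h⟩ => ⟨i, h⟩) fun ⟨i, _, h⟩ => ⟨i, h⟩
  · obtain ⟨k, hkK, hk⟩ := hcode hU hUn
    obtain ⟨l, hlK, hl⟩ := hcode hW hWn
    cases p with
    | true =>
      refine ⟨pair k l, (hf _).2 ⟨k, hkK, l, hlK, rfl, fun i _ hi => hUn i ((hk i).1 hi),
        fun i _ hi => hWn i ((hl i).1 hi),
        fun _ i _ j _ hi hj => hsub ((hk i).1 hi) ((hk j).1 hj), by simp, fun b _ hb => ?_⟩,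
        fun a ha => ?_⟩
      · refine (hr b hb).imp (fun ⟨i, hi, hib⟩ => ?_) fun ⟨i, hi, hib⟩ => ?_
        · exact ⟨i, ((hk i).2 hi).lt, (hk i).2 hi, by simpa using hib⟩
        · exact ⟨i, ((hl i).2 hi).lt, (hl i).2 hi, by simpa using hib⟩
      · simpa [PolarClauseHolds, clauseHolds_pair, hk, hl] using ha
    | false =>
      refine ⟨pair l k, (hf _).2 ⟨l, hlK, k, hkK, rfl, fun i _ hi => hWn i ((hl i).1 hi),
        fun i _ hi => hUn i ((hk i).1 hi), by simp,
        fun _ i _ j _ hi hj => hsub ((hk i).1 hi) ((hk j).1 hj), fun b _ hb => ?_⟩,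
        fun a ha => ?_⟩
      · refine (hr b hb).symm.imp (fun ⟨i, hi, hib⟩ => ?_) fun ⟨i, hi, hib⟩ => ?_
        · exact ⟨i, ((hl i).2 hi).lt, (hl i).2 hi, by simpa using hib⟩
        · exact ⟨i, ((hk i).2 hi).lt, (hk i).2 hi, by simpa using hib⟩
      · simpa [PolarClauseHolds, clauseHolds_pair, hk, hl, or_comm] using ha

/-- All clauses of the right shape that hold on `r` define `r`. Let `W` be the set of coordinates
where `a` equals `p`. If one of the elements of `r` required by `PolarClosed.inCode` did not exist,
the clause with literals `i ≠ p` for `i ∈ W`, possibly together with `j = p`, would hold on `r` and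
fail at `a`. -/
theorem PolarClosed.exists_clauses {p : Bool} {n r : M.Num} (h : PolarClosed p n r)
    (hrel : IsRel (pair n r)) : ∃ f,
    (∀ c, InCode c f → IsClause n c ∧ (p = true → HornClause c) ∧ (p = false → CoHornClause c)) ∧
      ∀ a, IsVec n a → (InCode a r ↔ ∀ c, InCode c f → ClauseHolds c a) := by
  obtain ⟨f, hf, hf'⟩ := L2Structure.exists_clauses p n r
  refine ⟨f, fun c hc => ⟨(hf c hc).1, (hf c hc).2.1, (hf c hc).2.2.1⟩,
    fun a ha => ⟨fun har c hc => (hf c hc).2.2.2 a har, fun hfa => ?_⟩⟩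
  have hW := setOf_mem (M := M) fun i => i < n ∧ (InCode i a ↔ p = true)
  refine h.inCode hrel ha ?_ fun j hj hja => ?_
  · by_contra! hne
    obtain ⟨c, hc, hca⟩ := hf' ∅ empty_mem_sets _ hW Set.subsingleton_empty (by simp)
      (fun i hi => hi.1) fun b hb => by
        obtain ⟨i, hi, hia, hib⟩ := hne b hb
        exact .inr ⟨i, ⟨hi, hia⟩, by tauto⟩
    rcases hca a (hfa c hc) with ⟨i, hi, -⟩ | ⟨i, hi, hia⟩
    · exact hi
    · exact hia hi.2
  · by_contra! hne
    have hj' : {j} ∈ M.sets := setOf_mem fun i => i = j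
    obtain ⟨c, hc, hca⟩ := hf' {j} hj' _ hW Set.subsingleton_singleton
      (by rintro i rfl; exact hj) (fun i hi => hi.1) fun b hb => by
        by_cases hab : ∀ i, i < n → (InCode i a ↔ p = true) → (InCode i b ↔ p = true)
        · exact .inl ⟨j, rfl, hne b hb hab⟩
        · push Not at hab
          obtain ⟨i, hi, hia, hib⟩ := hab
          exact .inr ⟨i, ⟨hi, hia⟩, by tauto⟩
    rcases hca a (hfa c hc) with ⟨i, rfl, hia⟩ | ⟨i, hi, hia⟩
    · exact hja hia
    · exact hia hi.2

theorem relHorn_iff {n r : M.Num} (hrel : IsRel (pair n r)) :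
    RelHorn (pair n r) ↔ PolarClosed true n r := by
  refine ⟨fun h => h.polarHorn.polarClosed hrel, fun h => ?_⟩
  obtain ⟨f, hf, hr⟩ := h.exists_clauses hrel
  exact ⟨n, r, rfl, f, fun c hc => ⟨(hf c hc).1, (hf c hc).2.1 rfl⟩, hr⟩

theorem relCoHorn_iff {n r : M.Num} (hrel : IsRel (pair n r)) :
    RelCoHorn (pair n r) ↔ PolarClosed false n r := by
  refine ⟨fun h => h.polarHorn.polarClosed hrel, fun h => ?_⟩
  obtain ⟨f, hf, hr⟩ := h.exists_clauses hrel
  exact ⟨n, r, rfl, f, fun c hc => ⟨(hf c hc).1, (hf c hc).2.2 rfl⟩, hr⟩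

end L2Structure

namespace L2Structure

/-! ### Codes of standard relations -/

variable {M : L2Structure.{u}}

theorem exists_boolVec (a : M.Num) (n : ℕ) :
    ∃ v : Fin n → Bool, ∀ i : Fin n, InCode (M.num i) a ↔ v i = true := by
  classical
  exact ⟨fun i => decide (InCode (M.num i) a), fun i => by simp⟩

variable [hM : Fact M.IsModelRCA₀]

/-- No nonstandard number lies below a numeral, so vectors of standard length in the model are
ordinary Boolean vectors. -/
theorem lt_num_iff {n : ℕ} {x : M.Num} : x < M.num n ↔ ∃ i : Fin n, x = M.num i := by
  induction n with
  | zero => simp [num, hM.out.not_lt_zero]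
  | succ n ih =>
    rw [num, hM.out.lt_succ_iff, ih]
    constructor
    · rintro (⟨i, rfl⟩ | rfl)
      exacts [⟨i.castSucc, rfl⟩, ⟨Fin.last n, rfl⟩]
    · rintro ⟨i, rfl⟩
      induction i using Fin.lastCases with
      | last => exact .inr rfl
      | cast i => exact .inl ⟨i, rfl⟩

theorem num_strictMono : StrictMono M.num :=
  strictMono_nat_of_lt_succ fun _ => Num.lt_succ_iff.2 le_rfl

theorem mem_sets_of_finite {X : Set M.Num} (hX : X.Finite) : X ∈ M.sets := by
  induction X, hX using Set.Finite.induction_on with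
  | empty => exact empty_mem_sets
  | @insert a X _ _ ih =>
    have := Fact.mk ih
    exact setOf_mem fun x => x = a ∨ x ∈ X

theorem exists_finCode_of_finite {X : Set M.Num} (hX : X.Finite) :
    ∃ c, IsFinCode c ∧ ∀ i, InCode i c ↔ i ∈ X := by
  obtain ⟨b, hb⟩ := hX.bddAbove
  exact exists_finCode (mem_sets_of_finite hX) (b := b + 1) fun i hi => Num.lt_succ_iff.2 (hb hi)

theorem exists_vec_num {n : ℕ} (v : Fin n → Bool) :
    ∃ a, IsVec (M.num n) a ∧ ∀ i : Fin n, InCode (M.num i) a ↔ v i = true := by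
  obtain ⟨a, ha, h⟩ := exists_finCode_of_finite
    (Set.finite_range fun i : {i : Fin n // v i = true} => M.num i.1)
  refine ⟨a, ⟨ha, fun i hi => ?_⟩, fun i => ?_⟩
  · obtain ⟨j, rfl⟩ := (h i).1 hi
    exact lt_num_iff.2 ⟨j, rfl⟩
  · rw [h]
    constructor
    · rintro ⟨j, hj⟩
      rw [← Fin.ext (num_strictMono.injective hj)]
      exact j.2
    · exact fun hi => ⟨⟨i, hi⟩, rfl⟩

theorem isVec_num_eq {n : ℕ} {a b : M.Num} (ha : IsVec (M.num n) a) (hb : IsVec (M.num n) b)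
    (h : ∀ i : Fin n, InCode (M.num i) a ↔ InCode (M.num i) b) : a = b :=
  ha.eq hb fun i hi => by
    obtain ⟨j, rfl⟩ := lt_num_iff.1 hi
    exact h j

theorem exists_codes (R : BoolRel) : ∃ ρ : M.Num, Codes ρ R := by
  choose a ha hav using fun v : Fin R.arity → Bool => exists_vec_num (M := M) v
  obtain ⟨r, hr, h⟩ := exists_finCode_of_finite (R.carrier.toFinite.image a)
  refine ⟨_, isRel_pair.2 ⟨hr, fun b hb => ?_⟩, r, rfl, fun v => ⟨fun hv => ?_, ?_⟩⟩
  · obtain ⟨v, -, rfl⟩ := (h b).1 hb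
    exact ha v
  · exact ⟨a v, (h _).2 ⟨v, hv, rfl⟩, hav v⟩
  · rintro ⟨b, hb, hbv⟩
    obtain ⟨w, hw, rfl⟩ := (h b).1 hb
    have : w = v := funext fun i => by rw [Bool.eq_iff_iff, ← hav w i, hbv i]
    exact this ▸ hw

theorem Codes.exists_eq {ρ : M.Num} {R : BoolRel} (h : Codes ρ R) :
    ∃ r, ρ = pair (M.num R.arity) r ∧ IsRel (pair (M.num R.arity) r) ∧
      ∀ (a : M.Num) (v : Fin R.arity → Bool), IsVec (M.num R.arity) a →
        (∀ i : Fin R.arity, InCode (M.num i) a ↔ v i = true) → (InCode a r ↔ v ∈ R.carrier) := by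
  obtain ⟨hrel, r, rfl, hr⟩ := h
  refine ⟨r, rfl, hrel, fun a v ha hav => ?_⟩
  rw [hr v]
  refine ⟨fun h => ⟨a, h, hav⟩, fun ⟨b, hb, hbv⟩ => ?_⟩
  rwa [isVec_num_eq ha ((isRel_pair.1 hrel).2 b hb) fun i => (hav i).trans (hbv i).symm]

/-- Least codes make the code of a relation unique; thus all formulas over `[x ≠ y]` involve the
same number. -/
theorem Codes.eq {ρ ρ' : M.Num} {R : BoolRel} (h : Codes ρ R) (h' : Codes ρ' R) : ρ = ρ' := by
  obtain ⟨r, rfl, hrel, hr⟩ := h.exists_eq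
  obtain ⟨r', rfl, hrel', hr'⟩ := h'.exists_eq
  rw [isRel_pair] at hrel hrel'
  rw [hrel.1.eq hrel'.1 fun a => ?_]
  obtain ⟨v, hv⟩ := exists_boolVec a R.arity
  exact ⟨fun ha => (hr' a v (hrel.2 a ha) hv).2 ((hr a v (hrel.2 a ha) hv).1 ha),
    fun ha => (hr a v (hrel'.2 a ha) hv).2 ((hr' a v (hrel'.2 a ha) hv).1 ha)⟩

end L2Structure

namespace L2Structure

/-! ### Templates -/

/-- A relation `(n, r)` and two vectors `b`, `c`. They stand for the formula `R(y₀, …, yₙ₋₁)` in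
four variables `x`, `z`, `t`, `f` in which `yᵢ` is `t`, `f`, `x`, `z` according as `(bᵢ, cᵢ)` is
`(1, 1)`, `(0, 0)`, `(1, 0)`, `(0, 1)`. -/
structure Template (M : L2Structure.{u}) where
  n : M.Num
  r : M.Num
  b : M.Num
  c : M.Num

variable {M : L2Structure.{u}}

namespace Template

/-- Among `x`, `z`, `t`, `f`, the property selected by `(bᵢ, cᵢ)`. -/
def Mix (τ : Template M) (X Z T F : Prop) (i : M.Num) : Prop :=
  (InCode i τ.b ∧ InCode i τ.c ∧ T) ∨ (¬ InCode i τ.b ∧ ¬ InCode i τ.c ∧ F) ∨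
    (InCode i τ.b ∧ ¬ InCode i τ.c ∧ X) ∨ (¬ InCode i τ.b ∧ InCode i τ.c ∧ Z)

/-- `ψ` is the formula given by the template and by the variables `x`, `z`, `t`, `f`. -/
def IsInstance (τ : Template M) (t f x z ψ : M.Num) : Prop :=
  ∃ s, ψ = pair (pair τ.n τ.r) s ∧ IsFinCode s ∧ ∀ q, InCode q s ↔
    ∃ i y, i < τ.n ∧ q = pair i y ∧ τ.Mix (y = x) (y = z) (y = t) (y = f) i

/-- The template is satisfied by the given truth values of `x`, `z`, `t`, `f`. -/
def Holds (τ : Template M) (X Z T F : Prop) : Prop :=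
  ∃ a, InCode a τ.r ∧ ∀ i, i < τ.n → (InCode i a ↔ τ.Mix X Z T F i)

theorem mix_iff_exists (τ : Template M) (t f x z i : M.Num) (P : M.Num → Prop) :
    τ.Mix (P x) (P z) (P t) (P f) i ↔
      ∃ y, τ.Mix (y = x) (y = z) (y = t) (y = f) i ∧ P y := by
  unfold Mix
  by_cases hb : InCode i τ.b <;> by_cases hc : InCode i τ.c <;> simp [hb, hc]

theorem existsUnique_mix (τ : Template M) (t f x z i : M.Num) :
    ∃! y, τ.Mix (y = x) (y = z) (y = t) (y = f) i := by
  unfold Mix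
  by_cases hb : InCode i τ.b <;> by_cases hc : InCode i τ.c <;> simp [hb, hc]

/-- With `t` true and `f` false, the values `x = 1`, `z = 0` reproduce the vector `b`, and the
exchanged values reproduce `c`. -/
theorem holds_of_left (τ : Template M) (h : InCode τ.b τ.r) : τ.Holds True False True False :=
  ⟨τ.b, h, fun i _ => by unfold Mix; tauto⟩

theorem holds_of_right (τ : Template M) (h : InCode τ.c τ.r) : τ.Holds False True True False :=
  ⟨τ.c, h, fun i _ => by unfold Mix; tauto⟩

variable [hM : Fact M.IsModelRCA₀]

theorem mix_le {τ : Template M} {t f x z i y : M.Num}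
    (h : τ.Mix (y = x) (y = z) (y = t) (y = f) i) : y ≤ x + z + t + f := by
  rcases h with ⟨-, -, rfl⟩ | ⟨-, -, rfl⟩ | ⟨-, -, rfl⟩ | ⟨-, -, rfl⟩
  · exact le_add_self.trans le_self_add
  · exact le_add_self
  · exact le_self_add.trans (le_self_add.trans le_self_add)
  · exact le_add_self.trans (le_self_add.trans le_self_add)

instance bddPred_mix (τ : Template M) (X Z T F : (ℕ → M.Num) → Prop) (f : (ℕ → M.Num) → M.Num)
    [BddPred X] [BddPred Z] [BddPred T] [BddPred F] [BddTerm f] :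
    BddPred fun e => τ.Mix (X e) (Z e) (T e) (F e) (f e) := by
  unfold Mix
  infer_instance

instance bddPred_isInstance (τ : Template M) (t f : M.Num) (g h k : (ℕ → M.Num) → M.Num)
    [BddTerm g] [BddTerm h] [BddTerm k] :
    BddPred fun e => τ.IsInstance t f (g e) (h e) (k e) := by
  have key (x z ψ : M.Num) : τ.IsInstance t f x z ψ ↔ ∃ s, s < ψ + 1 ∧
      ψ = pair (pair τ.n τ.r) s ∧ IsFinCode s ∧
      (∀ q, q < s → InCode q s → ∃ i, i < τ.n ∧ ∃ y, y < x + z + t + f + 1 ∧ q = pair i y ∧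
        τ.Mix (y = x) (y = z) (y = t) (y = f) i) ∧
      ∀ i, i < τ.n → ∀ y, y < x + z + t + f + 1 →
        τ.Mix (y = x) (y = z) (y = t) (y = f) i → InCode (pair i y) s := by
    constructor
    · rintro ⟨s, rfl, hs, h⟩
      refine ⟨s, Num.lt_succ_iff.2 (right_le_pair _ _), rfl, hs, fun q _ hq => ?_,
        fun i hi y _ hy => (h _).2 ⟨i, y, hi, rfl, hy⟩⟩
      obtain ⟨i, y, hi, rfl, hy⟩ := (h q).1 hq
      exact ⟨i, hi, y, Num.lt_succ_iff.2 (mix_le hy), rfl, hy⟩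
    · rintro ⟨s, -, rfl, hs, h₁, h₂⟩
      refine ⟨s, rfl, hs, fun q => ⟨fun hq => ?_, ?_⟩⟩
      · obtain ⟨i, hi, y, -, hy⟩ := h₁ q hq.lt hq
        exact ⟨i, y, hi, hy⟩
      · rintro ⟨i, y, hi, rfl, hy⟩
        exact h₂ i hi y (Num.lt_succ_iff.2 (mix_le hy)) hy
  have : BddPred fun e : ℕ → M.Num => τ.IsInstance t f (e 0) (e 1) (e 2) :=
    .congr fun e => key (e 0) (e 1) (e 2)
  exact this.subst₃ (P := fun x z ψ => τ.IsInstance t f x z ψ) g h k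

theorem exists_isInstance (τ : Template M) (t f x z : M.Num) : ∃ ψ, τ.IsInstance t f x z ψ := by
  obtain ⟨s, hs, h⟩ := exists_finCode (M := M)
    (setOf_mem fun q => ∃ i, i < τ.n ∧ ∃ y, y < x + z + t + f + 1 ∧ q = pair i y ∧
        τ.Mix (y = x) (y = z) (y = t) (y = f) i) (b := pair τ.n (x + z + t + f) + 1) (by
      rintro _ ⟨i, hi, y, hy, rfl, -⟩
      exact Num.lt_succ_iff.2 (pair_le_pair hi.le (Num.lt_succ_iff.1 hy)))
  refine ⟨_, s, rfl, hs, fun q => (h q).trans ⟨?_, ?_⟩⟩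
  · rintro ⟨i, hi, y, -, h⟩
    exact ⟨i, y, hi, h⟩
  · rintro ⟨i, y, hi, rfl, hy⟩
    exact ⟨i, hi, y, Num.lt_succ_iff.2 (mix_le hy), rfl, hy⟩

namespace IsInstance

variable {τ : Template M} {t f x z ψ : M.Num}

theorem unique {ψ' : M.Num} (h : τ.IsInstance t f x z ψ) (h' : τ.IsInstance t f x z ψ') :
    ψ = ψ' := by
  obtain ⟨s, rfl, hs, h⟩ := h
  obtain ⟨s', rfl, hs', h'⟩ := h'
  rw [hs.eq hs' fun q => (h q).trans (h' q).symm]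

theorem exists_isSeq (h : τ.IsInstance t f x z ψ) : ∃ s, ψ = pair (pair τ.n τ.r) s ∧
    IsSeq τ.n s ∧ ∀ i y, InCode (pair i y) s ↔
      i < τ.n ∧ τ.Mix (y = x) (y = z) (y = t) (y = f) i := by
  obtain ⟨s, rfl, hs, h⟩ := h
  have h' (i y : M.Num) : InCode (pair i y) s ↔
      i < τ.n ∧ τ.Mix (y = x) (y = z) (y = t) (y = f) i := by
    rw [h]
    constructor
    · rintro ⟨j, w, hj, hp, hw⟩
      rw [pair_inj] at hp
      obtain ⟨rfl, rfl⟩ := hp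
      exact ⟨hj, hw⟩
    · rintro ⟨hi, hy⟩
      exact ⟨i, y, hi, rfl, hy⟩
  refine ⟨s, rfl, ⟨hs, fun q hq => ?_, fun i hi => ?_⟩, h'⟩
  · obtain ⟨i, y, hi, rfl, -⟩ := (h q).1 hq
    exact ⟨i, y, hi, rfl⟩
  · simp only [h', and_iff_right hi]
    exact τ.existsUnique_mix t f x z i

theorem satisfies_iff (h : τ.IsInstance t f x z ψ) (ν : Set M.Num) :
    Satisfies ν ψ ↔ τ.Holds (x ∈ ν) (z ∈ ν) (t ∈ ν) (f ∈ ν) := by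
  obtain ⟨s, rfl, hs, h⟩ := h.exists_isSeq
  rw [satisfies_pair]
  refine exists_congr fun a => and_congr_right fun _ => ⟨fun ha i hi => ?_, fun ha i y hy => ?_⟩
  · rw [mix_iff_exists (P := (· ∈ ν))]
    obtain ⟨y, hy, hyu⟩ := hs.2.2 i hi
    rw [ha i y hy]
    constructor
    · exact fun hyν => ⟨y, ((h i y).1 hy).2, hyν⟩
    · rintro ⟨w, hw, hwν⟩
      exact hyu w ((h i w).2 ⟨hi, hw⟩) ▸ hwν
  · obtain ⟨hi, hy⟩ := (h i y).1 hy
    rw [ha i hi, mix_iff_exists (P := (· ∈ ν))]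
    constructor
    · rintro ⟨w, hw, hwν⟩
      rwa [(τ.existsUnique_mix t f x z i).unique hy hw]
    · exact fun hyν => ⟨y, hy, hyν⟩

theorem isFormulaOver (h : τ.IsInstance t f x z ψ) {S : Set M.Num} (hS : pair τ.n τ.r ∈ S)
    (hrel : IsRel (pair τ.n τ.r)) : IsFormulaOver S Set.univ ψ := by
  obtain ⟨s, rfl, hs, -⟩ := h.exists_isSeq
  exact ⟨_, _, s, rfl, hS, hrel, hs, fun _ _ _ => trivial⟩

theorem lt_of_mix (h : τ.IsInstance t f x z ψ) {i y : M.Num} (hi : i < τ.n)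
    (hy : τ.Mix (y = x) (y = z) (y = t) (y = f) i) : y < ψ := by
  obtain ⟨s, rfl, -, h⟩ := h.exists_isSeq
  exact lt_of_inCode_pair ((h i y).2 ⟨hi, hy⟩)

/-- Where `b` and `c` agree everywhere, neither `x` nor `z` occurs in the formula. -/
theorem change_vars (h : τ.IsInstance t f x z ψ)
    (hbc : ∀ i, i < τ.n → (InCode i τ.b ↔ InCode i τ.c)) (x' z' : M.Num) :
    τ.IsInstance t f x' z' ψ := by
  obtain ⟨s, hψ, hs, h⟩ := h
  refine ⟨s, hψ, hs, fun q => (h q).trans (exists₂_congr fun i y => and_congr_right fun hi => ?_)⟩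
  have := hbc i hi
  unfold Mix
  tauto

end IsInstance

end Template

end L2Structure

/-! ### The reduction of `[x ≠ y]` to a class with suitable templates -/

namespace L2Structure

variable {M : L2Structure.{u}}

instance BddPred.exists_fin {k : ℕ} (P : Fin k → (ℕ → M.Num) → Prop) [h : ∀ i, BddPred (P i)] :
    BddPred fun e => ∃ i, P i e := by
  induction k with
  | zero => exact .congr (P := fun _ => False) fun e => by simp
  | succ k ih =>
    have := ih fun i => P i.succ
    exact .congr (P := fun e => P 0 e ∨ ∃ i : Fin k, P i.succ e) fun e => Fin.exists_fin_succ

variable [hM : Fact M.IsModelRCA₀]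

/-- The formulas `x ≠ z` are the instances of a template. -/
theorem exists_neq_template : ∃ τ : Template M,
    (∀ X Z T F, τ.Holds X Z T F ↔ ¬ (X ↔ Z)) ∧
      ∀ V φ, IsFormulaOver (M.codesOf {BoolRel.neq}) V φ →
        ∃ x z, x < φ ∧ z < φ ∧ τ.IsInstance 0 0 x z φ := by
  classical
  obtain ⟨ρ, hρ⟩ := exists_codes (M := M) BoolRel.neq
  obtain ⟨r, rfl, hrel, hr⟩ := hρ.exists_eq
  obtain ⟨b, hb, hbv⟩ := exists_vec_num (M := M) ![true, false]
  obtain ⟨c, hc, hcv⟩ := exists_vec_num (M := M) ![false, true]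
  simp only [Fin.forall_fin_two] at hbv hcv
  let τ : Template M := ⟨M.num 2, r, b, c⟩
  have hlt (i : M.Num) : i < M.num 2 ↔ i = M.num 0 ∨ i = M.num 1 := by
    rw [lt_num_iff, Fin.exists_fin_two]; rfl
  have h₀ (X Z T F : Prop) : τ.Mix X Z T F (M.num 0) ↔ X := by
    have h₁ : InCode (M.num 0) b := hbv.1.2 rfl
    have h₂ : ¬ InCode (M.num 0) c := fun h => by simpa using hcv.1.1 h
    simp [Template.Mix, τ, h₁, h₂]
  have h₁ (X Z T F : Prop) : τ.Mix X Z T F (M.num 1) ↔ Z := by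
    have h₁ : ¬ InCode (M.num 1) b := fun h => by simpa using hbv.2.1 h
    have h₂ : InCode (M.num 1) c := hcv.2.2 rfl
    simp [Template.Mix, τ, h₁, h₂]
  refine ⟨τ, fun X Z T F => ⟨?_, fun hXZ => ?_⟩, ?_⟩
  · rintro ⟨a, ha, hai⟩
    have hX := (hai _ ((hlt _).2 (.inl rfl))).trans (h₀ X Z T F)
    have hZ := (hai _ ((hlt _).2 (.inr rfl))).trans (h₁ X Z T F)
    obtain ⟨v, hv⟩ := exists_boolVec a 2
    have hvR : v 0 ≠ v 1 := (hr a v ((isRel_pair.1 hrel).2 a ha) hv).1 ha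
    rw [← hX, ← hZ]
    intro h
    exact hvR (Bool.eq_iff_iff.2 (((hv 0).symm.trans h).trans (hv 1)))
  · obtain ⟨a, ha, hav⟩ := exists_vec_num (M := M) ![decide X, decide Z]
    refine ⟨a, (hr a _ ha hav).2 ?_, fun i hi => ?_⟩
    · change decide X ≠ decide Z
      simpa using hXZ
    · rcases (hlt i).1 hi with rfl | rfl
      · rw [h₀]
        exact (hav 0).trans (by simp)
      · rw [h₁]
        exact (hav 1).trans (by simp)
  · rintro V _ ⟨n, r', s, rfl, ⟨R, rfl, hR⟩, -, hs, -⟩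
    have := hR.eq hρ
    rw [pair_inj] at this
    obtain ⟨rfl, rfl⟩ := this
    obtain ⟨x, hx, hxu⟩ := hs.2.2 _ ((hlt _).2 (.inl rfl))
    obtain ⟨z, hz, hzu⟩ := hs.2.2 _ ((hlt _).2 (.inr rfl))
    refine ⟨x, z, lt_of_inCode_pair hx, lt_of_inCode_pair hz, s, rfl, hs.1,
      fun q => ⟨fun hq => ?_, ?_⟩⟩
    · obtain ⟨i, y, hi, rfl⟩ := hs.2.1 q hq
      refine ⟨i, y, hi, rfl, ?_⟩
      rcases (hlt i).1 hi with rfl | rfl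
      · rw [h₀]
        exact hxu y hq
      · rw [h₁]
        exact hzu y hq
    · rintro ⟨i, y, hi, rfl, hy⟩
      rcases (hlt i).1 hi with rfl | rfl
      · rw [h₀] at hy
        exact hy ▸ hx
      · rw [h₁] at hy
        exact hy ▸ hz

/-- The set of the pairs `(x, z)` for which the instance of the template at `x`, `z` is in `C`. -/
theorem setOf_edges_mem (τ : Template M) {C : Set M.Num} (hC : C ∈ M.sets) :
    {p | ∃ φ, φ ∈ C ∧ ∃ x, x < p + 1 ∧ ∃ z, z < p + 1 ∧ p = pair x z ∧
      τ.IsInstance 0 0 x z φ} ∈ M.sets := by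
  have := Fact.mk hC
  -- Each pair has exactly one instance of the template, so "some instance is in `C`" and "every
  -- instance is in `C`" agree.
  refine setOf_exists_mem
    (fun φ p => φ ∈ C ∧ ∃ x, x < p + 1 ∧ ∃ z, z < p + 1 ∧ p = pair x z ∧ τ.IsInstance 0 0 x z φ)
    (fun φ p => ∃ x, x < p + 1 ∧ ∃ z, z < p + 1 ∧ p = pair x z ∧
      (τ.IsInstance 0 0 x z φ → φ ∈ C)) fun p => ⟨?_, fun h => ?_⟩
  · rintro ⟨φ, hφ, x, hx, z, hz, rfl, h⟩ φ'
    exact ⟨x, hx, z, hz, rfl, fun h' => h.unique h' ▸ hφ⟩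
  · obtain ⟨x, hx, z, hz, rfl, -⟩ := h 0
    obtain ⟨φ, hφ⟩ := τ.exists_isInstance 0 0 x z
    obtain ⟨x', -, z', -, hp, h'⟩ := h φ
    rw [pair_inj] at hp
    obtain ⟨rfl, rfl⟩ := hp
    exact ⟨φ, h' hφ, x, hx, z, hz, rfl, hφ⟩

theorem Num.add_self_inj {x y : M.Num} : x + x = y + y ↔ x = y := by
  refine ⟨fun h => ?_, fun h => h ▸ rfl⟩
  rcases lt_trichotomy x y with hlt | h' | hlt
  · exact absurd h (add_lt_add hlt hlt).ne
  · exact h'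
  · exact absurd h (add_lt_add hlt hlt).ne'

theorem Num.add_self_ne (x y : M.Num) : x + x ≠ y + y + 1 := by
  intro h
  rcases le_or_gt x y with hle | hlt
  · exact (Num.lt_succ_iff.2 (add_le_add hle hle)).ne h
  · have := add_lt_add_of_le_of_lt (Num.succ_le_iff.2 hlt) hlt
    rw [add_right_comm] at this
    exact this.ne' h

/-- Each edge `x ≠ z` is replaced by one instance of every template. By `hb` and `hc` a solution of
the edges extends to the new formulas; by `hneq` a solution of the new formulas solves the edges.
The condition `hocc`, that `x` and `z` both occur or neither does, makes the new set of formulas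
definable by bounded search. -/
theorem lrsat_neq_of_templates {S : Set M.Num} {k : ℕ} (τ : Fin k → Template M)
    (hS : ∀ j, pair (τ j).n (τ j).r ∈ S) (hrel : ∀ j, IsRel (pair (τ j).n (τ j).r))
    (hb : ∀ j, InCode (τ j).b (τ j).r) (hc : ∀ j, InCode (τ j).c (τ j).r)
    (hocc : ∀ j, (∀ i, i < (τ j).n → (InCode i (τ j).b ↔ InCode i (τ j).c)) ∨
      (∃ i, i < (τ j).n ∧ InCode i (τ j).b ∧ ¬ InCode i (τ j).c) ∧
        ∃ i, i < (τ j).n ∧ ¬ InCode i (τ j).b ∧ InCode i (τ j).c)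
    (hneq : ∀ X Z T F, (∀ j, (τ j).Holds X Z T F) → ¬ (X ↔ Z))
    (h : M.LRSAT S) : M.LRSAT (M.codesOf {BoolRel.neq}) := by
  intro V hV C hC L hL hVinf hLV hLinf hform hsat
  obtain ⟨σ, hσ, hσC⟩ := exists_neq_template (M := M)
  have := Fact.mk hC
  have := Fact.mk hL
  let E := {p | ∃ φ, φ ∈ C ∧ ∃ x, x < p + 1 ∧ ∃ z, z < p + 1 ∧ p = pair x z ∧
    σ.IsInstance 0 0 x z φ}
  have hE : E ∈ M.sets := setOf_edges_mem σ hC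
  have := Fact.mk hE
  have hmemE {x z : M.Num} : pair x z ∈ E ↔ ∃ φ ∈ C, σ.IsInstance 0 0 x z φ := by
    constructor
    · rintro ⟨φ, hφ, x', -, z', -, hp, h⟩
      rw [pair_inj] at hp
      obtain ⟨rfl, rfl⟩ := hp
      exact ⟨φ, hφ, h⟩
    · rintro ⟨φ, hφ, h⟩
      exact ⟨φ, hφ, x, Num.lt_succ_iff.2 (left_le_pair _ _), z,
        Num.lt_succ_iff.2 (right_le_pair _ _), rfl, h⟩
  rcases C.eq_empty_or_nonempty with rfl | ⟨φ₀, hφ₀⟩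
  · exact ⟨L, hL, subset_rfl, hLinf, true, fun D _ hD =>
      ⟨_, univ_mem_sets, fun φ hφ => (hD hφ).elim, by simp⟩⟩
  obtain ⟨x₀, z₀, -, -, h₀⟩ := hσC V φ₀ (hform φ₀ hφ₀)
  have hE₀ : pair x₀ z₀ ∈ E := hmemE.2 ⟨φ₀, hφ₀, h₀⟩
  -- The variable `x` is renamed `x + x`; the fresh variables `1` and `3` stand for the constants.
  let C' := {ψ | ∃ j, ∃ x, x < ψ + x₀ + z₀ + 1 ∧ ∃ z, z < ψ + x₀ + z₀ + 1 ∧ pair x z ∈ E ∧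
    (τ j).IsInstance 1 (1 + 1 + 1) (x + x) (z + z) ψ}
  have hC' : C' ∈ M.sets := setOf_mem fun ψ => ∃ j, ∃ x, x < ψ + x₀ + z₀ + 1 ∧
    ∃ z, z < ψ + x₀ + z₀ + 1 ∧ pair x z ∈ E ∧
      (τ j).IsInstance 1 (1 + 1 + 1) (x + x) (z + z) ψ
  have hmemC' {j : Fin k} {x z ψ : M.Num} (hxz : pair x z ∈ E)
      (hψ : (τ j).IsInstance 1 (1 + 1 + 1) (x + x) (z + z) ψ) : ψ ∈ C' := by
    -- If `x` and `z` occur in the instance, its code bounds them. Otherwise the instance is the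
    -- same for every edge, and the fixed edge `(x₀, z₀)` is found by the search.
    rcases hocc j with hbc | ⟨⟨i, hi, hib, hic⟩, i', hi', hib', hic'⟩
    · refine ⟨j, x₀, Num.lt_succ_iff.2 (le_add_self.trans le_self_add), z₀,
        Num.lt_succ_iff.2 le_add_self, hE₀, hψ.change_vars hbc _ _⟩
    · have hx : x + x < ψ := hψ.lt_of_mix hi (.inr (.inr (.inl ⟨hib, hic, rfl⟩)))
      have hz : z + z < ψ := hψ.lt_of_mix hi' (.inr (.inr (.inr ⟨hib', hic', rfl⟩)))
      have hle : ψ ≤ ψ + x₀ + z₀ := le_self_add.trans le_self_add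
      exact ⟨j, x, Num.lt_succ_iff.2 ((le_self_add.trans hx.le).trans hle), z,
        Num.lt_succ_iff.2 ((le_self_add.trans hz.le).trans hle), hxz, hψ⟩
  have hsat' : FinSatisfiable C' := by
    rintro D ⟨-, b, hDb⟩ hDC'
    let K := pair (b + x₀ + z₀ + 1) (b + x₀ + z₀ + 1)
    -- The formulas of `D` come from edges with code at most `K`, and `B` bounds the formulas of `C`
    -- giving these edges.
    obtain ⟨B, hB⟩ := collection (fun φ p => p ∈ E → φ ∈ C ∧ ∃ x, x < p + 1 ∧ ∃ z, z < p + 1 ∧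
        p = pair x z ∧ σ.IsInstance 0 0 x z φ) (K + 1) fun p _ => by
      by_cases hp : p ∈ E
      · obtain ⟨φ, hφ⟩ := hp
        exact ⟨φ, fun _ => hφ⟩
      · exact ⟨0, fun h => absurd h hp⟩
    obtain ⟨ν, hν, hνC⟩ := hsat.exists_sat hC B
    have := Fact.mk hν
    -- Even numbers copy `ν`, the variable `1` is true, and `3` is false because it is odd and not
    -- `1`.
    refine ⟨_, setOf_mem fun y => y = 1 ∨ ∃ x, x < y + 1 ∧ y = x + x ∧ x ∈ ν, fun ψ hψ => ?_⟩
    obtain ⟨j, x, hx, z, hz, hxz, hψx⟩ := hDC' hψ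
    have hψb : ψ + x₀ + z₀ + 1 ≤ b + x₀ + z₀ + 1 := by
      gcongr
      exact (hDb ψ hψ).le
    obtain ⟨φ, hφB, hφ⟩ := hB _ (Num.lt_succ_iff.2
      (pair_le_pair (hx.le.trans hψb) (hz.le.trans hψb)))
    obtain ⟨hφC, x', -, z', -, hp, hφx⟩ := hφ hxz
    rw [pair_inj] at hp
    obtain ⟨rfl, rfl⟩ := hp
    have hνφ := (hσ _ _ _ _).1 ((hφx.satisfies_iff ν).1 (hνC φ hφC hφB))
    have hdouble (y : M.Num) : (y + y = 1 ∨ ∃ x, x < y + y + 1 ∧ y + y = x + x ∧ x ∈ ν) ↔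
        y ∈ ν := by
      constructor
      · rintro (h | ⟨x, -, h, hx⟩)
        · exact absurd h (by simpa using Num.add_self_ne y 0)
        · rwa [Num.add_self_inj.1 h]
      · exact fun hy => .inr ⟨y, Num.lt_succ_iff.2 le_self_add, rfl, hy⟩
    have hthree : ¬ ((1 + 1 + 1 : M.Num) = 1 ∨
        ∃ x, x < (1 + 1 + 1 : M.Num) + 1 ∧ 1 + 1 + 1 = x + x ∧ x ∈ ν) := by
      rintro (h | ⟨x, -, h, -⟩)
      · simp at h
      · exact Num.add_self_ne x 1 h.symm
    rw [hψx.satisfies_iff]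
    simp only [Set.mem_ofPred_eq, hdouble, hthree, true_or]
    by_cases hxν : x ∈ ν
    · have hzν : z ∉ ν := fun hzν => hνφ (by simp [hxν, hzν])
      simpa only [hxν, hzν] using (τ j).holds_of_left (hb j)
    · have hzν : z ∈ ν := by
        by_contra hzν
        exact hνφ (by simp [hxν, hzν])
      simpa only [hxν, hzν] using (τ j).holds_of_right (hc j)
  obtain ⟨H', hH', hH'L, hH'inf, v, hv⟩ := h Set.univ univ_mem_sets C' hC' _
    (setOf_mem fun y => ∃ x, x < y + 1 ∧ y = x + x ∧ x ∈ L)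
    (fun b => ⟨b + 1, trivial, Num.lt_succ_iff.2 le_rfl⟩) (Set.subset_univ _)
    (fun b => by
      obtain ⟨x, hx, hbx⟩ := hLinf b
      exact ⟨x + x, ⟨x, Num.lt_succ_iff.2 le_self_add, rfl, hx⟩, hbx.trans_le le_self_add⟩)
    (by
      rintro ψ ⟨j, x, -, z, -, -, hψ⟩
      exact hψ.isFormulaOver (hS j) (hrel j)) hsat'
  have := Fact.mk hH'
  refine ⟨{x | x + x ∈ H'}, setOf_mem fun x => x + x ∈ H', fun x hx => ?_, fun b => ?_, v,
    fun D ⟨_, b, hDb⟩ hDC => ?_⟩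
  · obtain ⟨y, -, hy, hyL⟩ := hH'L hx
    rwa [Num.add_self_inj.1 hy]
  · obtain ⟨y, hy, hby⟩ := hH'inf (b + b)
    obtain ⟨x, -, rfl, -⟩ := hH'L hy
    exact ⟨x, hy, lt_of_not_ge fun hle => (add_le_add hle hle).not_gt hby⟩
  -- Conversely, `B j` bounds the instances of template `j` at the edges given by formulas below
  -- `b`; as `k` is standard, the sum bounds all of them.
  · choose B hB using fun j => collection (fun ψ p => p ∈ E → ∃ x, x < p + 1 ∧ ∃ z, z < p + 1 ∧
        p = pair x z ∧ (τ j).IsInstance 1 (1 + 1 + 1) (x + x) (z + z) ψ) (pair b b + 1)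
        fun p _ => by
      by_cases hp : p ∈ E
      · obtain ⟨φ, -, x, hx, z, hz, rfl, -⟩ := hp
        obtain ⟨ψ, hψ⟩ := (τ j).exists_isInstance 1 (1 + 1 + 1) (x + x) (z + z)
        exact ⟨ψ, fun _ => ⟨x, hx, z, hz, rfl, hψ⟩⟩
      · exact ⟨0, fun h => absurd h hp⟩
    have := Fact.mk hC'
    obtain ⟨ν, hν, hνC', hνH'⟩ := hv {ψ | ψ ∈ C' ∧ ψ < ∑ j, B j}
      ⟨setOf_mem fun ψ => ψ ∈ C' ∧ ψ < ∑ j, B j, _, fun ψ hψ => hψ.2⟩ fun ψ hψ => hψ.1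
    have := Fact.mk hν
    refine ⟨{x | x + x ∈ ν}, setOf_mem fun x => x + x ∈ ν, fun φ hφ => ?_,
      fun x hx => hνH' _ hx⟩
    obtain ⟨x, z, hx, hz, hφx⟩ := hσC V φ (hform φ (hDC hφ))
    have hxz : pair x z ∈ E := hmemE.2 ⟨φ, hDC hφ, hφx⟩
    rw [hφx.satisfies_iff, hσ]
    -- Nothing is known about the values of the variables `1` and `3` here, so `hneq` must cover all
    -- `T` and `F`.
    refine hneq _ _ (1 ∈ ν) (1 + 1 + 1 ∈ ν) fun j => ?_
    have hφb := (hDb φ hφ).le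
    obtain ⟨ψ, hψB, hψ⟩ := hB j _ (Num.lt_succ_iff.2
      (pair_le_pair (hx.le.trans hφb) (hz.le.trans hφb)))
    obtain ⟨x', -, z', -, hp, hψ⟩ := hψ hxz
    rw [pair_inj] at hp
    obtain ⟨rfl, rfl⟩ := hp
    exact (hψ.satisfies_iff ν).1 (hνC' ψ ⟨hmemC' hxz hψ, hψB.trans_le
      (Finset.single_le_sum (fun _ _ => zero_le) (Finset.mem_univ j))⟩)

end L2Structure

namespace L2Structure

/-! ### Classes that are not tame -/

variable {M : L2Structure.{u}}

namespace Template.Holds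

variable {n r a b c : M.Num} {X Z T F : Prop}

theorem exists_const (hab : ∀ i, i < n → (InCode i b ↔ ¬ InCode i a)) (hXZ : X ↔ Z)
    (h : Template.Holds ⟨n, r, a, b⟩ X Z T F) :
    ∃ d, InCode d r ∧ ∀ i, i < n → (InCode i d ↔ X) := by
  obtain ⟨d, hd, h⟩ := h
  refine ⟨d, hd, fun i hi => (h i hi).trans ?_⟩
  have := hab i hi
  by_cases hi : InCode i a <;> simp_all [Mix]

theorem exists_of_eq (h : Template.Holds ⟨n, r, a, a⟩ X Z T F) : ∃ d, InCode d r ∧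
    ∀ i, i < n → (InCode i d ↔ (InCode i a ∧ T) ∨ (¬ InCode i a ∧ F)) := by
  obtain ⟨d, hd, h⟩ := h
  refine ⟨d, hd, fun i hi => (h i hi).trans ?_⟩
  by_cases hi : InCode i a <;> simp [Mix, hi]

theorem exists_and (hX : ¬ X) (hZ : ¬ Z) (hT : T) (hF : ¬ F)
    (h : Template.Holds ⟨n, r, b, c⟩ X Z T F) :
    ∃ d, InCode d r ∧ ∀ i, i < n → (InCode i d ↔ InCode i b ∧ InCode i c) := by
  obtain ⟨d, hd, h⟩ := h
  refine ⟨d, hd, fun i hi => (h i hi).trans ?_⟩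
  simp [Mix, hX, hZ, hT, hF]

theorem exists_or (hX : X) (hZ : Z) (hT : T) (hF : ¬ F)
    (h : Template.Holds ⟨n, r, b, c⟩ X Z T F) :
    ∃ d, InCode d r ∧ ∀ i, i < n → (InCode i d ↔ InCode i b ∨ InCode i c) := by
  obtain ⟨d, hd, h⟩ := h
  refine ⟨d, hd, fun i hi => (h i hi).trans ?_⟩
  by_cases hb : InCode i b <;> by_cases hc : InCode i c <;> simp [Mix, hX, hZ, hT, hF, hb, hc]

end Template.Holds

variable [hM : Fact M.IsModelRCA₀]

theorem exists_of_not_relHorn {n r : M.Num} (hrel : IsRel (pair n r)) (h : ¬ RelHorn (pair n r)) :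
    ∃ b c, InCode b r ∧ InCode c r ∧
      ∀ a, InCode a r → ¬ ∀ i, i < n → (InCode i a ↔ InCode i b ∧ InCode i c) := by
  rw [relHorn_iff hrel] at h
  unfold PolarClosed at h
  push Not at h
  obtain ⟨b, c, d, hb, hc, hd, hdi, hdr⟩ := h
  refine ⟨b, c, hb, hc, fun a ha hai => hdr ?_⟩
  rwa [hd.eq ((isRel_pair.1 hrel).2 a ha) fun i hi => ?_]
  have := hdi i hi
  simp only [iff_true] at this
  rw [this, hai i hi]

theorem exists_of_not_relCoHorn {n r : M.Num} (hrel : IsRel (pair n r))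
    (h : ¬ RelCoHorn (pair n r)) : ∃ b c, InCode b r ∧ InCode c r ∧
      ∀ a, InCode a r → ¬ ∀ i, i < n → (InCode i a ↔ InCode i b ∨ InCode i c) := by
  rw [relCoHorn_iff hrel] at h
  unfold PolarClosed at h
  push Not at h
  obtain ⟨b, c, d, hb, hc, hd, hdi, hdr⟩ := h
  refine ⟨b, c, hb, hc, fun a ha hai => hdr ?_⟩
  rwa [hd.eq ((isRel_pair.1 hrel).2 a ha) fun i hi => ?_]
  have := hdi i hi
  simp only [Bool.false_eq_true, iff_false] at this
  rw [← not_iff_not, this, hai i hi, not_or]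

theorem exists_compl (n a : M.Num) :
    ∃ a', IsVec n a' ∧ ∀ i, i < n → (InCode i a' ↔ ¬ InCode i a) := by
  obtain ⟨a', ha', h⟩ := exists_vec n (setOf_mem fun i => ¬ InCode i a)
  exact ⟨a', ha', fun i hi => (h i).trans (and_iff_right hi)⟩

/-- Fix `a₀ ∈ r₀` and `a₁ ∈ r₁`. If both complements belong to their relations, the two relations
with only `x` and `z` inserted suffice: `x = z` would put the same constant vector in both, but `r₀`
omits `0` and `r₁` omits `1`. Otherwise inserting `t`, `f` along `a₀` and `a₁` forces `t = 1`, `f =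
0`; then the missing minimum in `r₂` excludes `x = z = 0`, and the missing maximum in `r₃` excludes
`x = z = 1`. -/
theorem lrsat_neq_of_not_relTame {S : Set M.Num} (hrel : ∀ ρ ∈ S, IsRel ρ)
    (hne : ∀ ρ ∈ S, RelNonempty ρ) (hS : ¬ RelTame S) (h : M.LRSAT S) :
    M.LRSAT (M.codesOf {BoolRel.neq}) := by
  unfold RelTame at hS
  push Not at hS
  obtain ⟨⟨ρ₀, hρ₀, h₀⟩, ⟨ρ₁, hρ₁, h₁⟩, ⟨ρ₂, hρ₂, h₂⟩, ρ₃, hρ₃, h₃⟩ := hS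
  obtain ⟨n₀, r₀, rfl, a₀, ha₀⟩ := hne _ hρ₀
  obtain ⟨n₁, r₁, rfl, a₁, ha₁⟩ := hne _ hρ₁
  obtain ⟨n₂, r₂, rfl, -⟩ := hne _ hρ₂
  obtain ⟨n₃, r₃, rfl, -⟩ := hne _ hρ₃
  obtain ⟨b₂, c₂, hb₂, hc₂, h₂⟩ := exists_of_not_relHorn (hrel _ hρ₂) h₂
  obtain ⟨b₃, c₃, hb₃, hc₃, h₃⟩ := exists_of_not_relCoHorn (hrel _ hρ₃) h₃
  replace h₀ (a : M.Num) (ha : InCode a r₀) : ∃ i, i < n₀ ∧ InCode i a := by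
    by_contra! hc
    exact h₀ ⟨n₀, r₀, rfl, a, ha, hc⟩
  replace h₁ (a : M.Num) (ha : InCode a r₁) : ∃ i, i < n₁ ∧ ¬ InCode i a := by
    by_contra! hc
    exact h₁ ⟨n₁, r₁, rfl, a, ha, hc⟩
  obtain ⟨a₀', hv₀, ha₀'⟩ := exists_compl n₀ a₀
  obtain ⟨a₁', hv₁, ha₁'⟩ := exists_compl n₁ a₁
  by_cases hcompl : InCode a₀' r₀ ∧ InCode a₁' r₁
  · refine lrsat_neq_of_templates ![⟨n₀, r₀, a₀, a₀'⟩, ⟨n₁, r₁, a₁, a₁'⟩] ?_ ?_ ?_ ?_ ?_ ?_ h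
    · exact Fin.forall_fin_two.2 ⟨hρ₀, hρ₁⟩
    · exact Fin.forall_fin_two.2 ⟨hrel _ hρ₀, hrel _ hρ₁⟩
    · exact Fin.forall_fin_two.2 ⟨ha₀, ha₁⟩
    · exact Fin.forall_fin_two.2 hcompl
    · refine Fin.forall_fin_two.2 ⟨.inr ⟨?_, ?_⟩, .inr ⟨?_, ?_⟩⟩
      · obtain ⟨i, hi, hia⟩ := h₀ a₀ ha₀
        exact ⟨i, hi, hia, fun h => (ha₀' i hi).1 h hia⟩
      · obtain ⟨i, hi, hia⟩ := h₀ a₀' hcompl.1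
        exact ⟨i, hi, (ha₀' i hi).1 hia, hia⟩
      · obtain ⟨i, hi, hia⟩ := h₁ a₁' hcompl.2
        exact ⟨i, hi, not_not.1 fun h => hia ((ha₁' i hi).2 h), hia⟩
      · obtain ⟨i, hi, hia⟩ := h₁ a₁ ha₁
        exact ⟨i, hi, hia, (ha₁' i hi).2 hia⟩
    · rintro X Z T F hτ hXZ
      obtain ⟨hτ₀, hτ₁⟩ := Fin.forall_fin_two.1 hτ
      obtain ⟨b, hb, hbi⟩ := Template.Holds.exists_const ha₀' hXZ hτ₀
      obtain ⟨c, hc, hci⟩ := Template.Holds.exists_const ha₁' hXZ hτ₁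
      obtain ⟨i, hi, hib⟩ := h₀ b hb
      obtain ⟨j, hj, hjc⟩ := h₁ c hc
      exact hjc ((hci j hj).2 ((hbi i hi).1 hib))
  · refine lrsat_neq_of_templates
      ![⟨n₀, r₀, a₀, a₀⟩, ⟨n₁, r₁, a₁, a₁⟩, ⟨n₂, r₂, b₂, c₂⟩, ⟨n₃, r₃, b₃, c₃⟩]
      ?_ ?_ ?_ ?_ ?_ ?_ h <;> simp only [Fin.forall_fin_succ, IsEmpty.forall_iff, and_true]
    · exact ⟨hρ₀, hρ₁, hρ₂, hρ₃⟩
    · exact ⟨hrel _ hρ₀, hrel _ hρ₁, hrel _ hρ₂, hrel _ hρ₃⟩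
    · exact ⟨ha₀, ha₁, hb₂, hb₃⟩
    · exact ⟨ha₀, ha₁, hc₂, hc₃⟩
    · refine ⟨.inl fun _ _ => Iff.rfl, .inl fun _ _ => Iff.rfl, .inr ⟨?_, ?_⟩, .inr ⟨?_, ?_⟩⟩
      -- Since the minimum (for `r₃`, the maximum) is missing, the two vectors are incomparable, so
      -- `x` and `z` both occur.
      · by_contra! hbc
        exact h₂ b₂ hb₂ fun i hi => ⟨fun hib => ⟨hib, hbc i hi hib⟩, And.left⟩
      · by_contra! hbc
        refine h₂ c₂ hc₂ fun i hi => ⟨fun hic => ⟨?_, hic⟩, And.right⟩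
        by_contra hib
        exact hbc i hi hib hic
      · by_contra! hbc
        exact h₃ c₃ hc₃ fun i hi => ⟨.inr, fun h => h.elim (hbc i hi) id⟩
      · by_contra! hbc
        refine h₃ b₃ hb₃ fun i hi => ⟨.inl, fun h => h.elim id fun hic => ?_⟩
        by_contra hib
        exact hbc i hi hib hic
    · rintro X Z T F ⟨hτ₀, hτ₁, hτ₂, hτ₃⟩ hXZ
      obtain ⟨b, hb, hbi⟩ := Template.Holds.exists_of_eq hτ₀
      obtain ⟨c, hc, hci⟩ := Template.Holds.exists_of_eq hτ₁
      -- Equal values would give a constant vector forbidden in `r₁` or `r₀`; the exchanged values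
      -- would put both complements in the relations.
      have hTF : T ∧ ¬ F := by
        by_cases hT : T <;> by_cases hF : F <;>
          simp only [hT, hF, and_true, and_false, or_false, false_or, em, iff_true] at hbi hci
        · obtain ⟨i, hi, hic⟩ := h₁ c hc
          exact absurd (hci i hi) hic
        · exact ⟨hT, hF⟩
        · refine absurd ⟨?_, ?_⟩ hcompl
          · rwa [hv₀.eq ((isRel_pair.1 (hrel _ hρ₀)).2 b hb) fun i hi =>
              (ha₀' i hi).trans (hbi i hi).symm]
          · rwa [hv₁.eq ((isRel_pair.1 (hrel _ hρ₁)).2 c hc) fun i hi =>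
              (ha₁' i hi).trans (hci i hi).symm]
        · obtain ⟨i, hi, hib⟩ := h₀ b hb
          exact ((hbi i hi).1 hib).elim
      by_cases hX : X
      · obtain ⟨d, hd, hdi⟩ := Template.Holds.exists_or hX (hXZ.1 hX) hTF.1 hTF.2 hτ₃
        exact h₃ d hd hdi
      · obtain ⟨d, hd, hdi⟩ := Template.Holds.exists_and hX (mt hXZ.2 hX) hTF.1 hTF.2 hτ₂
        exact h₂ d hd hdi

end L2Structure

/-! ### Closure properties of standard relations -/

namespace BoolRel

/-- `R` is closed under the coordinatewise minimum if `p` is `true`, and under the coordinatewise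
maximum if `p` is `false`. -/
def PolarClosed (p : Bool) (R : BoolRel) : Prop :=
  ∀ u v w : Fin R.arity → Bool, u ∈ R.carrier → v ∈ R.carrier →
    (∀ i, w i = p ↔ u i = p ∧ v i = p) → w ∈ R.carrier

end BoolRel

namespace BoolClause

variable {n : ℕ}

/-- The variables `i` with a literal `i = p`. -/
def lits (c : BoolClause n) (p : Bool) : Finset (Fin n) := bif p then c.pos else c.neg

theorem holds_iff (c : BoolClause n) (p : Bool) (v : Fin n → Bool) :
    c.Holds v ↔ (∃ i ∈ c.lits p, v i = p) ∨ ∃ i ∈ c.lits (!p), v i ≠ p := by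
  cases p <;> simp [Holds, lits, or_comm]

/-- The clause with literals `i = p` for `i ∈ U` and `i ≠ p` for `i ∈ W`. -/
def ofLits (p : Bool) (U W : Finset (Fin n)) : BoolClause n :=
  bif p then ⟨U, W⟩ else ⟨W, U⟩

theorem lits_ofLits (p : Bool) (U W : Finset (Fin n)) : (ofLits p U W).lits p = U := by
  cases p <;> rfl

theorem lits_ofLits_not (p : Bool) (U W : Finset (Fin n)) : (ofLits p U W).lits (!p) = W := by
  cases p <;> rfl

instance : Finite (BoolClause n) :=
  Finite.of_injective (fun c => (c.pos, c.neg)) fun c d h => by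
    cases c; cases d; simp_all

end BoolClause

namespace BoolRel

/-- A relation is closed iff it is defined by clauses with at most one literal `i = p`. -/
theorem polarClosed_iff (p : Bool) (R : BoolRel) : R.PolarClosed p ↔
    ∃ F : Finset (BoolClause R.arity), (∀ c ∈ F, (c.lits p).card ≤ 1) ∧
      ∀ v, v ∈ R.carrier ↔ ∀ c ∈ F, c.Holds v := by
  classical
  constructor
  · intro h
    refine ⟨(Set.toFinite {c : BoolClause R.arity | (c.lits p).card ≤ 1 ∧
      ∀ v ∈ R.carrier, c.Holds v}).toFinset, fun c hc => ?_, fun v => ⟨fun hv c hc => ?_,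
        fun hv => ?_⟩⟩
    · exact ((Set.Finite.mem_toFinset _).1 hc).1
    · exact ((Set.Finite.mem_toFinset _).1 hc).2 v hv
    -- Otherwise the clause with literals `i = p` for `i ∈ U` and `i ≠ p` where `v i = p` would hold
    -- on `R` but fail at `v`.
    have key (U : Finset (Fin R.arity)) (hU : U.card ≤ 1) (hUv : ∀ j ∈ U, v j ≠ p) :
        ∃ u ∈ R.carrier, (∀ i, v i = p → u i = p) ∧ ∀ j ∈ U, u j ≠ p := by
      by_contra! hno
      let c := BoolClause.ofLits p U {i | v i = p}
      have hc : c.Holds v := hv c <| (Set.Finite.mem_toFinset _).2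
        ⟨by rwa [BoolClause.lits_ofLits], fun u hu => by
          rw [BoolClause.holds_iff _ p, BoolClause.lits_ofLits, BoolClause.lits_ofLits_not]
          by_cases hle : ∀ i, v i = p → u i = p
          · exact .inl (hno u hu hle)
          · push Not at hle
            obtain ⟨i, hi, hiu⟩ := hle
            exact .inr ⟨i, by simpa using hi, hiu⟩⟩
      rw [BoolClause.holds_iff _ p, BoolClause.lits_ofLits, BoolClause.lits_ofLits_not] at hc
      rcases hc with ⟨i, hi, hiv⟩ | ⟨i, hi, hiv⟩
      · exact hUv i hi hiv
      · exact hiv (by simpa using hi)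
    -- Closure merges the witnesses for single coordinates; with all coordinates where `v i ≠ p`,
    -- the merged vector is `v`.
    have key' (J : Finset (Fin R.arity)) : (∀ j ∈ J, v j ≠ p) →
        ∃ u ∈ R.carrier, (∀ i, v i = p → u i = p) ∧ ∀ j ∈ J, u j ≠ p := by
      induction J using Finset.induction_on with
      | empty => exact fun _ => key ∅ (by simp) (by simp)
      | insert j J _ ih =>
        intro hJ
        obtain ⟨u, hu, hvu, huJ⟩ := ih fun i hi => hJ i (Finset.mem_insert_of_mem hi)
        obtain ⟨w, hw, hvw, hwj⟩ := key {j} (by simp) (by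
          simpa using hJ j (Finset.mem_insert_self _ _))
        refine ⟨fun i => if u i = p ∧ w i = p then p else !p, h u w _ hu hw fun i => ?_,
          fun i hi => by simp [hvu i hi, hvw i hi], fun i hi => ?_⟩
        · by_cases hi : u i = p ∧ w i = p <;> simp [hi]
        · rcases Finset.mem_insert.1 hi with rfl | hi
          · simp [hwj i (by simp)]
          · simp [huJ i hi]
    obtain ⟨u, hu, hvu, huJ⟩ := key' {j | v j ≠ p} (by simp)
    have : v = u := funext fun i => by
      by_cases hi : v i = p
      · rw [hi, hvu i hi]
      · have := huJ i (by simpa using hi)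
        revert hi this
        cases v i <;> cases u i <;> cases p <;> simp
    exact this ▸ hu
  · rintro ⟨F, hF, hR⟩ u v w hu hv hw
    rw [hR] at hu hv ⊢
    intro c hc
    have hu := (c.holds_iff p u).1 (hu c hc)
    have hv := (c.holds_iff p v).1 (hv c hc)
    rw [c.holds_iff p]
    rcases hu with ⟨i, hi, hiu⟩ | ⟨i, hi, hiu⟩
    · rcases hv with ⟨j, hj, hjv⟩ | ⟨j, hj, hjv⟩
      · obtain rfl := Finset.card_le_one.1 (hF c hc) i hi j hj
        exact .inl ⟨i, hi, (hw i).2 ⟨hiu, hjv⟩⟩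
      · exact .inr ⟨j, hj, fun h => hjv ((hw j).1 h).2⟩
    · exact .inr ⟨i, hi, fun h => hiu ((hw i).1 h).1⟩

theorem isHorn_iff (R : BoolRel) : R.IsHorn ↔ R.PolarClosed true :=
  (polarClosed_iff true R).symm

theorem isCoHorn_iff (R : BoolRel) : R.IsCoHorn ↔ R.PolarClosed false :=
  (polarClosed_iff false R).symm

end BoolRel

/-! ### Absoluteness of the four conditions for standard relations -/

namespace L2Structure

variable {M : L2Structure.{u}} [hM : Fact M.IsModelRCA₀] {ρ : M.Num} {R : BoolRel}

theorem Codes.relNonempty (h : Codes ρ R) (hR : R.carrier.Nonempty) : RelNonempty ρ := by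
  obtain ⟨r, rfl, -, hr⟩ := h.exists_eq
  obtain ⟨v, hv⟩ := hR
  obtain ⟨a, ha, hav⟩ := exists_vec_num (M := M) v
  exact ⟨_, r, rfl, a, (hr a v ha hav).2 hv⟩

theorem Codes.relZeroValid_iff (h : Codes ρ R) : RelZeroValid ρ ↔ R.IsValid false := by
  obtain ⟨r, rfl, hrel, hr⟩ := h.exists_eq
  constructor
  · rintro ⟨n', r', h, a, ha, hai⟩
    rw [pair_inj] at h
    obtain ⟨rfl, rfl⟩ := h
    refine (hr a _ ((isRel_pair.1 hrel).2 a ha) fun i => ?_).1 ha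
    simpa using hai _ (lt_num_iff.2 ⟨i, rfl⟩)
  · intro hv
    obtain ⟨a, ha, hav⟩ := exists_vec_num (M := M) fun _ : Fin R.arity => false
    refine ⟨_, r, rfl, a, (hr a _ ha hav).2 hv, fun i hi => ?_⟩
    obtain ⟨j, rfl⟩ := lt_num_iff.1 hi
    simpa using hav j

theorem Codes.relOneValid_iff (h : Codes ρ R) : RelOneValid ρ ↔ R.IsValid true := by
  obtain ⟨r, rfl, hrel, hr⟩ := h.exists_eq
  constructor
  · rintro ⟨n', r', h, a, ha, hai⟩
    rw [pair_inj] at h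
    obtain ⟨rfl, rfl⟩ := h
    refine (hr a _ ((isRel_pair.1 hrel).2 a ha) fun i => ?_).1 ha
    simpa using hai _ (lt_num_iff.2 ⟨i, rfl⟩)
  · intro hv
    obtain ⟨a, ha, hav⟩ := exists_vec_num (M := M) fun _ : Fin R.arity => true
    refine ⟨_, r, rfl, a, (hr a _ ha hav).2 hv, fun i hi => ?_⟩
    obtain ⟨j, rfl⟩ := lt_num_iff.1 hi
    simpa using hav j

/-- Closure speaks only of vectors of standard length, which are the same inside and outside the
model. Clause sets coded in the model may be nonstandard, so the horn conditions are compared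
through closure. -/
theorem polarClosed_iff_of_codes {r : M.Num} (hrel : IsRel (pair (M.num R.arity) r))
    (hr : ∀ (a : M.Num) (v : Fin R.arity → Bool), IsVec (M.num R.arity) a →
      (∀ i : Fin R.arity, InCode (M.num i) a ↔ v i = true) → (InCode a r ↔ v ∈ R.carrier))
    (p : Bool) : PolarClosed p (M.num R.arity) r ↔ R.PolarClosed p := by
  have hp {P : Prop} {b : Bool} (h : P ↔ b = true) : (P ↔ p = true) ↔ b = p := by
    rw [h, ← Bool.eq_iff_iff]
  constructor
  · intro h u v w hu hv hw
    obtain ⟨a, ha, hau⟩ := exists_vec_num (M := M) u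
    obtain ⟨b, hb, hbv⟩ := exists_vec_num (M := M) v
    obtain ⟨c, hc, hcw⟩ := exists_vec_num (M := M) w
    rw [← hr c w hc hcw]
    refine h a b c ((hr a u ha hau).2 hu) ((hr b v hb hbv).2 hv) hc fun i hi => ?_
    obtain ⟨j, rfl⟩ := lt_num_iff.1 hi
    rw [hp (hau j), hp (hbv j), hp (hcw j), hw j]
  · intro h a b c ha hb hc habc
    obtain ⟨u, hu⟩ := exists_boolVec a R.arity
    obtain ⟨v, hv⟩ := exists_boolVec b R.arity
    obtain ⟨w, hw⟩ := exists_boolVec c R.arity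
    rw [hr c w hc hw]
    refine h u v w ((hr a u ((isRel_pair.1 hrel).2 a ha) hu).1 ha)
      ((hr b v ((isRel_pair.1 hrel).2 b hb) hv).1 hb) fun j => ?_
    rw [← hp (hu j), ← hp (hv j), ← hp (hw j), habc _ (lt_num_iff.2 ⟨j, rfl⟩)]

theorem Codes.relHorn_iff (h : Codes ρ R) : RelHorn ρ ↔ R.IsHorn := by
  obtain ⟨r, rfl, hrel, hr⟩ := h.exists_eq
  rw [L2Structure.relHorn_iff hrel, R.isHorn_iff, polarClosed_iff_of_codes hrel hr]

theorem Codes.relCoHorn_iff (h : Codes ρ R) : RelCoHorn ρ ↔ R.IsCoHorn := by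
  obtain ⟨r, rfl, hrel, hr⟩ := h.exists_eq
  rw [L2Structure.relCoHorn_iff hrel, R.isCoHorn_iff, polarClosed_iff_of_codes hrel hr]

theorem forall_codesOf {S : Set BoolRel} {P : M.Num → Prop} {Q : BoolRel → Prop}
    (h : ∀ {ρ R}, Codes ρ R → (P ρ ↔ Q R)) : (∀ ρ ∈ M.codesOf S, P ρ) ↔ ∀ R ∈ S, Q R := by
  constructor
  · intro hP R hR
    obtain ⟨ρ, hρ⟩ := exists_codes (M := M) R
    exact (h hρ).1 (hP ρ ⟨R, hR, hρ⟩)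
  · rintro hQ ρ ⟨R, hR, hρ⟩
    exact (h hρ).2 (hQ R hR)

theorem relTame_codesOf_iff {S : Set BoolRel} : RelTame (M.codesOf S) ↔ BoolRel.Tame S := by
  unfold RelTame BoolRel.Tame
  rw [forall_codesOf Codes.relZeroValid_iff, forall_codesOf Codes.relOneValid_iff,
    forall_codesOf Codes.relHorn_iff, forall_codesOf Codes.relCoHorn_iff]

end L2Structure

theorem theorem3p4 :
    (∀ S : Set BoolRel,
      (BoolRel.Tame S → RCA₀Proves.{u} fun M => M.LRSAT (M.codesOf S)) ∧
      ((∀ R ∈ S, R.carrier.Nonempty) → ¬ BoolRel.Tame S →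
        RCA₀Proves.{u} fun M => M.LRSAT (M.codesOf S) → M.LRSAT (M.codesOf {BoolRel.neq}))) ∧
    (RCA₀Proves.{u} fun M => ∀ S : Set M.Num, (∀ ρ ∈ S, L2Structure.IsRel ρ) →
      (L2Structure.RelTame S → M.LRSAT S) ∧
      ((∀ ρ ∈ S, L2Structure.RelNonempty ρ) → ¬ L2Structure.RelTame S →
        M.LRSAT S → M.LRSAT (M.codesOf {BoolRel.neq}))) := by
  refine ⟨fun S => ⟨fun hS M hM => ?_, fun hne hS M hM => ?_⟩, fun M hM S hrel => ?_⟩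
  · have := Fact.mk hM
    exact L2Structure.lrsat_of_relTame (L2Structure.relTame_codesOf_iff.2 hS)
  · have := Fact.mk hM
    refine L2Structure.lrsat_neq_of_not_relTame ?_ ?_ (mt L2Structure.relTame_codesOf_iff.1 hS)
    · rintro ρ ⟨R, -, hρ⟩
      exact hρ.1
    · rintro ρ ⟨R, hR, hρ⟩
      exact hρ.relNonempty (hne R hR)
  · have := Fact.mk hM
    exact ⟨L2Structure.lrsat_of_relTame, L2Structure.lrsat_neq_of_not_relTame hrel⟩
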